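/- Conventions. An alphabet is a finite set with the discrete topology, and $A^{\mathbb Z^2}$ has the product topology and the shift action $(gx)(h)=x(h-g)$, $g,h\in\mathbb Z^2$; $O(x)$ is the orbit of $x$. A subshift is a closed shift-invariant subset of $A^{\mathbb Z^2}$. A pattern is an element of $A^S$ with $S\subseteq\mathbb Z^2$ finite; it appears in $x$ if it is the restriction to $S$ of some shift $gx$. A shift of finite type (SFT) is the set of all configurations in which no pattern of some fixed finite set appears. A subshift $W$ has a fully supported measure if there is a shift-invariant Borel probability measure whose topological support is $W$. For $x,x'\in W$, $(x,x')$ is a transitivity pair in $W$ if for all patterns $v,v'$ appearing in $x$ and $x'$ respectively there is a point of $W$ in which both $v$ and $v'$ appear. For an open cover $\mathcal U$ of a subshift $X$ let $\mathcal U_n=\bigvee_{g\in[0,n)^2}g^{-1}\mathcal U$, let $\mathcal N(\mathcal U_n)$ be the smallest cardinality of a subcover of $\mathcal U_n$, and let $h(X,\mathcal U)=\lim_{n\to\infty}\log\mathcal N(\mathcal U_n)/n^2$. A pair $(y,y')\in X^2$ is an entropy-or-equal pair in $X$ if $y=y'$, or if $y\neq y'$ and $h(X,\{X\setminus K,X\setminus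 L\})>0$ for all disjoint closed neighbourhoods $K$ of $y$ and $L$ of $y'$ in $X$. Theorem. For every alphabet $A$ there are an alphabet $B$ and a map $f$ that takes each orbit of a point of $A^{\mathbb Z^2}$ to a nonempty union of orbits of points of $B^{\mathbb Z^2}$ with the following properties, where $f(x)$ denotes $f(O(x))$ and $f(W)=\bigcup_{x\in W}f(x)$ for $W\subseteq A^{\mathbb Z^2}$: \begin{enumerate} \item If $O(x)\neq O(x')$, then $f(O(x))\cap f(O(x'))=\emptyset$. \item If $W\subseteq A^{\mathbb Z^2}$ is a subshift (respectively, an SFT), then $f(W)$ is a subshift (respectively, an SFT). \item If $W$ is a subshift with a fully supported measure, then $f(W)$ has a fully supported measure. \item If $W$ is a subshift with a fully supported measure and $x,x'\in W$, the following are equivalent: (i) $(x,x')$ is a transitivity pair in $W$; (ii) $(y,y')$ is an entropy-or-equal pair in $f(W)$ for some $(y,y')\in f(x)\times f(x')$; (iii) $(y,y')$ is an entropy-or-equal pair in $f(W)$ for every $(y,y')\in f(x)\times f(x')$. \item If $W$ is a subshift, $S\subseteq W$ is a shift-invariant set and $x\in W$, then $x\in\overline S$ if and only if $f(x)\subseteq\overline{f(S)}$.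 \end{enumerate} -/

import Mathlib

open Set Filter Topology MeasureTheory

namespace Fabric

/-- Two-dimensional configurations over the alphabet `A`, with the product topology. -/
abbrev Config (A : Type*) := ℤ × ℤ → A

/-- The shift action: `(g x)(h) = x (h - g)`. -/
def shift {A : Type*} (g : ℤ × ℤ) (x : Config A) : Config A := fun h => x (h - g)

/-- The orbit `O(x)` under the shift action. -/
def orbit {A : Type*} (x : Config A) : Set (Config A) := range fun g => shift g x

/-- A set of configurations closed under all shifts (hence under their inverses). -/
def ShiftInvariant {A : Type*} (X : Set (Config A)) : Prop :=
  ∀ g : ℤ × ℤ, ∀ x ∈ X, shift g x ∈ X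

/-- A pattern: a map to `A` from a finite subset of the plane. -/
structure Pattern (A : Type*) where
  shape : Finset (ℤ × ℤ)
  symbol : shape → A

/-- `w` appears in `x`: some translate of `x` restricts to `w`. -/
def Pattern.AppearsIn {A : Type*} (w : Pattern A) (x : Config A) : Prop :=
  ∃ g : ℤ × ℤ, ∀ s : w.shape, shift g x s = w.symbol s

/-- `W_F`: the configurations in which no pattern of `F` appears. -/
def avoiding {A : Type*} (F : Set (Pattern A)) : Set (Config A) :=
  {x | ∀ w ∈ F, ¬ w.AppearsIn x}

/-- A subshift: a closed shift-invariant set of configurations. -/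
def IsSubshift {A : Type*} [TopologicalSpace A] (X : Set (Config A)) : Prop :=
  IsClosed X ∧ ShiftInvariant X

/-- A shift of finite type. -/
def IsSFT {A : Type*} (X : Set (Config A)) : Prop :=
  ∃ F : Set (Pattern A), F.Finite ∧ X = avoiding F

/-- `X` carries a shift-invariant Borel probability measure whose topological support is `X`. -/
def HasFullySupportedMeasure {A : Type*} [TopologicalSpace A] (X : Set (Config A)) : Prop :=
  letI : MeasurableSpace (Config A) := borel (Config A)
  ∃ μ : Measure (Config A), IsProbabilityMeasure μ ∧
    (∀ g : ℤ × ℤ, MeasurePreserving (shift g) μ μ) ∧ μ.support = X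

/-- `(x, x')` is a transitivity pair of `W`: any pattern of `x` and any pattern of `x'` appear
together in some point of `W`. -/
def IsTransitivityPair {A : Type*} (W : Set (Config A)) (x x' : Config A) : Prop :=
  x ∈ W ∧ x' ∈ W ∧ ∀ v v' : Pattern A, v.AppearsIn x → v'.AppearsIn x' →
    ∃ z ∈ W, v.AppearsIn z ∧ v'.AppearsIn z

/-- The square `[0, n)²`. -/
def box (n : ℕ) : Set (ℤ × ℤ) := Ico 0 (n : ℤ) ×ˢ Ico 0 (n : ℤ)

/-- The common refinement of the shifted covers `g⁻¹ 𝒰`, `g ∈ [0, n)²`. -/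
def refinement {A : Type*} (𝒰 : Set (Set (Config A))) (n : ℕ) : Set (Set (Config A)) :=
  {V | ∃ c : ℤ × ℤ → Set (Config A), (∀ g ∈ box n, c g ∈ 𝒰) ∧
    V = ⋂ g ∈ box n, shift g ⁻¹' c g}

/-- The smallest cardinality of a (finite) subfamily of `𝒱` that covers `X`. -/
noncomputable def coverNumber {A : Type*} (X : Set (Config A)) (𝒱 : Set (Set (Config A))) : ℕ :=
  sInf {k | ∃ F : Finset (Set (Config A)), (F : Set (Set (Config A))) ⊆ 𝒱 ∧
    X ⊆ ⋃₀ (F : Set (Set (Config A))) ∧ F.card = k}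

/-- The topological entropy of `X` relative to the cover `𝒰`, `lim log N(𝒰_n) / n²`; for an open
cover of a subshift the limit exists by subadditivity, so that it agrees with the upper limit. -/
noncomputable def coverEntropy {A : Type*} (X : Set (Config A)) (𝒰 : Set (Set (Config A))) :
    EReal :=
  limsup (fun n : ℕ => ((Real.log (coverNumber X (refinement 𝒰 n)) / (n : ℝ) ^ 2 : ℝ) : EReal))
    atTop

/-- `(x, y)` is an entropy pair of `X`: the points are distinct, and for all disjoint closed
neighbourhoods `K`, `L` of `x`, `y` in `X`, the cover of `X` by the complements of `K` and `L`
has positive entropy. -/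
def IsEntropyPair {A : Type*} [TopologicalSpace A] (X : Set (Config A)) (x y : Config A) : Prop :=
  x ∈ X ∧ y ∈ X ∧ x ≠ y ∧
    ∀ K L : Set (Config A), K ⊆ X → L ⊆ X → IsClosed K → IsClosed L →
      K ∈ 𝓝[X] x → L ∈ 𝓝[X] y → Disjoint K L → 0 < coverEntropy X {X \ K, X \ L}

/-- `(x, y) ∈ X²` with `x = y` or `(x, y)` an entropy pair of `X`. -/
def IsEntropyOrEqualPair {A : Type*} [TopologicalSpace A] (X : Set (Config A))
    (x y : Config A) : Prop :=
  x ∈ X ∧ y ∈ X ∧ (x = y ∨ IsEntropyPair X x y)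

/-- `f(W) = ⋃_{x ∈ W} f(x)` for a set-valued map `f`. -/
def setImage {A B : Type*} (f : Config A → Set (Config B)) (W : Set (Config A)) :
    Set (Config B) :=
  ⋃ x ∈ W, f x

end Fabric

namespace Fabric

/-! ### Shifts, orbits, windows -/

section Basics

variable {A B : Type*}

/-! The map `f` applies one construction, the fabric, twice. A weave of `x` writes the symbol `x (i,
j)` at position `(j, 4 i + q (i, j))`, where `q` is an integer displacement that is 1-Lipschitz for
the `ℓ¹` metric, and leaves a blank everywhere else; the fabric of `x` consists of all weaves of
points of its orbit. Call the written positions knots. Consecutive knots of a column are 3 to 5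
apart, and knots with the same `i` in adjacent columns differ in height by at most 1. So the indices
of knots can be followed from one knot to the next, and a window of a weave around a knot determines
a window of `x` (`agree_of_weave`). This rigidity makes images of distinct orbits disjoint, reflects
closures and transitivity pairs, and lets local rules recognise weaves
(`LocallyWoven.exists_eq_weave`), so that finite type is preserved. Compactness of normalized
displacements preserves closedness (`isSubshift_fabric`), and periodic displacements carry invariant
measures over (`measure_fabric`).

The freedom in `q` creates entropy. One weave moves a window along the first coordinate of `x` by a
bounded amount and exchanges the coordinates, so a second weave moves it along the other one. If two
windows occur in `z` at a fixed offset near each of many sparse sites, then two weaves can bring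
either window to a prescribed place at every site, all choices being independent
(`exists_double_weave`). For a transitivity pair the set of points showing both windows at such an
offset has positive measure, hence some `z` has such sites with positive density, and every pair of
images is an entropy-or-equal pair (`IsTransitivityPair.isEntropyOrEqualPair`).

Conversely, if no orbit visits both of two neighbourhoods, the cover by their complements has
entropy zero (`coverEntropy_le_zero`). An entropy-or-equal pair of `f(W)` is therefore a
transitivity pair of `f(W)`, and decoding both weaves gives a transitivity pair of `W`. -/

@[simp] theorem shift_mk (a b i j : ℤ) (x : Config A) :
    shift (a, b) x (i, j) = x (i - a, j - b) := rfl

@[simp] theorem shift_shift (g h : ℤ × ℤ) (x : Config A) :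
    shift g (shift h x) = shift (g + h) x := by
  funext u
  simp only [shift, sub_sub]

@[simp] theorem shift_zero (x : Config A) : shift 0 x = x := by
  funext u
  simp [shift]

theorem mem_orbit_self (x : Config A) : x ∈ orbit x := ⟨0, shift_zero x⟩

theorem shift_mem_orbit (g : ℤ × ℤ) (x : Config A) : shift g x ∈ orbit x := ⟨g, rfl⟩

theorem orbit_shift (g : ℤ × ℤ) (x : Config A) : orbit (shift g x) = orbit x := by
  ext y
  constructor
  · rintro ⟨h, rfl⟩
    exact ⟨h + g, by simp⟩
  · rintro ⟨h, rfl⟩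
    exact ⟨h - g, by simp⟩

theorem orbit_eq_of_mem {x y : Config A} (h : y ∈ orbit x) : orbit y = orbit x := by
  obtain ⟨g, rfl⟩ := h
  exact orbit_shift g x

theorem ShiftInvariant.orbit_subset {X : Set (Config A)} (hX : ShiftInvariant X) {x : Config A}
    (hx : x ∈ X) : orbit x ⊆ X := by
  rintro _ ⟨g, rfl⟩
  exact hX g x hx

theorem appearsIn_shift_iff {w : Pattern A} {g : ℤ × ℤ} {x : Config A} :
    w.AppearsIn (shift g x) ↔ w.AppearsIn x := by
  constructor
  · rintro ⟨h, hh⟩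
    exact ⟨h + g, by simpa using hh⟩
  · rintro ⟨h, hh⟩
    exact ⟨h - g, by simpa using hh⟩

theorem shiftInvariant_avoiding (F : Set (Pattern A)) : ShiftInvariant (avoiding F) := by
  intro g x hx w hw h
  exact hx w hw (appearsIn_shift_iff.1 h)

/-- The configurations `x` and `y` agree on the square `[-r, r]²`. -/
def Agree (r : ℕ) (x y : Config A) : Prop :=
  ∀ i j : ℤ, i.natAbs ≤ r → j.natAbs ≤ r → x (i, j) = y (i, j)

theorem Agree.symm {r : ℕ} {x y : Config A} (h : Agree r x y) : Agree r y x :=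
  fun i j hi hj => (h i j hi hj).symm

theorem Agree.trans {r : ℕ} {x y z : Config A} (h : Agree r x y) (h' : Agree r y z) :
    Agree r x z :=
  fun i j hi hj => (h i j hi hj).trans (h' i j hi hj)

theorem Agree.refl (r : ℕ) (x : Config A) : Agree r x x := fun _ _ _ _ => rfl

theorem Agree.mono {r s : ℕ} (hrs : r ≤ s) {x y : Config A} (h : Agree s x y) : Agree r x y :=
  fun i j hi hj => h i j (hi.trans hrs) (hj.trans hrs)

theorem exists_natAbs_le (S : Finset (ℤ × ℤ)) :
    ∃ r : ℕ, ∀ s ∈ S, s.1.natAbs ≤ r ∧ s.2.natAbs ≤ r := by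
  refine ⟨S.sup fun s => s.1.natAbs + s.2.natAbs, fun s hs => ?_⟩
  have := Finset.le_sup (f := fun s : ℤ × ℤ => s.1.natAbs + s.2.natAbs) hs
  omega

/-- The points of the square `[-r, r]²`. -/
noncomputable def square (r : ℕ) : Finset (ℤ × ℤ) :=
  Finset.Icc (-r : ℤ) r ×ˢ Finset.Icc (-r : ℤ) r

theorem mem_square {r : ℕ} {u : ℤ × ℤ} : u ∈ square r ↔ u.1.natAbs ≤ r ∧ u.2.natAbs ≤ r := by
  simp only [square, Finset.mem_product, Finset.mem_Icc]
  omega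

/-- The pattern that `x` shows on the square `[-r, r]²`. -/
noncomputable def window (r : ℕ) (x : Config A) : Pattern A := ⟨square r, fun s => x s⟩

theorem window_appearsIn_iff {r : ℕ} {x y : Config A} :
    (window r x).AppearsIn y ↔ ∃ g, Agree r (shift g y) x := by
  refine exists_congr fun g => ?_
  constructor
  · intro h i j hi hj
    exact h ⟨(i, j), mem_square.2 ⟨hi, hj⟩⟩
  · rintro h ⟨⟨i, j⟩, hs⟩
    exact h i j (mem_square.1 hs).1 (mem_square.1 hs).2

theorem window_appearsIn_self (r : ℕ) (x : Config A) : (window r x).AppearsIn x :=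
  window_appearsIn_iff.2 ⟨0, by simpa using Agree.refl r x⟩

theorem Pattern.AppearsIn.exists_agree {w : Pattern A} {x : Config A} (h : w.AppearsIn x) :
    ∃ g, ∃ r, ∀ y, Agree r y (shift g x) → w.AppearsIn y := by
  obtain ⟨g, hg⟩ := h
  obtain ⟨r, hr⟩ := exists_natAbs_le w.shape
  refine ⟨g, r, fun y hy => ⟨0, fun s => ?_⟩⟩
  rw [shift_zero, ← hg s]
  exact hy _ _ (hr _ s.2).1 (hr _ s.2).2

/-- A transitivity pair, in terms of windows. -/
theorem IsTransitivityPair.exists_agree {W : Set (Config A)} {x x' : Config A}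
    (hW : ShiftInvariant W) (h : IsTransitivityPair W x x') (r : ℕ) :
    ∃ z ∈ W, ∃ g, Agree r z x ∧ Agree r (shift g z) x' := by
  obtain ⟨z, hz, hv, hv'⟩ :=
    h.2.2 _ _ (window_appearsIn_self r x) (window_appearsIn_self r x')
  obtain ⟨g, hg⟩ := window_appearsIn_iff.1 hv
  obtain ⟨g', hg'⟩ := window_appearsIn_iff.1 hv'
  exact ⟨shift g z, hW g z hz, g' - g, hg, by simpa using hg'⟩

theorem isTransitivityPair_of_agree {W : Set (Config A)} {x x' : Config A}
    (hx : x ∈ W) (hx' : x' ∈ W)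
    (h : ∀ (r : ℕ) (g g' : ℤ × ℤ), ∃ z ∈ W, ∃ k k',
      Agree r (shift k z) (shift g x) ∧ Agree r (shift k' z) (shift g' x')) :
    IsTransitivityPair W x x' := by
  refine ⟨hx, hx', fun v v' hv hv' => ?_⟩
  obtain ⟨g, r, hr⟩ := hv.exists_agree
  obtain ⟨g', r', hr'⟩ := hv'.exists_agree
  obtain ⟨z, hz, k, k', hk, hk'⟩ := h (max r r') g g'
  exact ⟨z, hz, appearsIn_shift_iff.1 (hr _ (hk.mono (le_max_left _ _))),
    appearsIn_shift_iff.1 (hr' _ (hk'.mono (le_max_right _ _)))⟩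

end Basics

/-! ### Agreement on squares as a neighbourhood basis -/

section Topology

variable {A : Type*} [TopologicalSpace A]

theorem continuous_shift (g : ℤ × ℤ) : Continuous (shift g : Config A → Config A) :=
  continuous_pi fun _ => continuous_apply _

variable [DiscreteTopology A]

theorem isClopen_agree (r : ℕ) (x : Config A) : IsClopen {y | Agree r y x} := by
  have : {y | Agree r y x} = ⋂ u ∈ square r, (fun y : Config A => y u) ⁻¹' {x u} := by
    ext y
    simp only [mem_ofPred_eq, mem_iInter, mem_preimage, mem_singleton_iff, mem_square]
    exact ⟨fun h u hu => h _ _ hu.1 hu.2, fun h i j hi hj => h (i, j) ⟨hi, hj⟩⟩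
  rw [this]
  exact isClopen_biInter_finset fun u _ => (isClopen_discrete _).preimage (continuous_apply u)

theorem nhds_hasBasis_agree (x : Config A) :
    (𝓝 x).HasBasis (fun _ : ℕ => True) fun r => {y | Agree r y x} := by
  refine ⟨fun t => ⟨fun ht => ?_, ?_⟩⟩
  · rw [nhds_pi, Filter.mem_pi'] at ht
    obtain ⟨I, s, hs, hst⟩ := ht
    obtain ⟨r, hr⟩ := exists_natAbs_le I
    refine ⟨r, trivial, fun y hy => hst fun u hu => ?_⟩
    have : y u = x u := hy _ _ (hr u hu).1 (hr u hu).2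
    rw [this]
    exact mem_of_mem_nhds (hs u)
  · rintro ⟨r, -, hr⟩
    exact mem_of_superset ((isClopen_agree r x).isOpen.mem_nhds (Agree.refl r x)) hr

theorem mem_closure_iff_agree {S : Set (Config A)} {x : Config A} :
    x ∈ closure S ↔ ∀ r, ∃ y ∈ S, Agree r y x := by
  simp [mem_closure_iff_nhds_basis (nhds_hasBasis_agree x)]

end Topology

/-! ### The weave of a configuration along a Lipschitz displacement -/

section Weave

variable {A B : Type*}

/-- `1`-Lipschitz integer functions on the plane, for the `ℓ¹` metric. -/
def Lip (q : Config ℤ) : Prop :=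
  ∀ i j i' j' : ℤ, q (i, j) ≤ q (i', j') + (i - i').natAbs + (j - j').natAbs

theorem Lip.shift_add {q : Config ℤ} (hq : Lip q) (g : ℤ × ℤ) (m : ℤ) :
    Lip fun u => shift g q u + m := by
  intro i j i' j'
  obtain ⟨a, b⟩ := g
  have := hq (i - a) (j - b) (i' - a) (j' - b)
  simp only [shift_mk]
  omega

theorem Lip.knot_injective {q : Config ℤ} (hq : Lip q) {i i' j : ℤ}
    (h : 4 * i + q (i, j) = 4 * i' + q (i', j)) : i = i' := by
  have := hq i j i' j
  have := hq i' j i j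
  omega

open Classical in
/-- The symbol `x (i, j)` is written at the position `(j, 4 i + q (i, j))`, and all other
positions are blank. -/
noncomputable def weave (e : Option A ≃ B) (q : Config ℤ) (x : Config A) : Config B := fun b =>
  if h : ∃ i, 4 * i + q (i, b.1) = b.2 then e (some (x (h.choose, b.1))) else e none

variable {e : Option A ≃ B} {q q' : Config ℤ} {x x' : Config A}

theorem weave_knot (hq : Lip q) {i j k : ℤ} (h : 4 * i + q (i, j) = k) :
    weave e q x (j, k) = e (some (x (i, j))) := by
  have h' : ∃ i, 4 * i + q (i, j) = k := ⟨i, h⟩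
  have : h'.choose = i := hq.knot_injective (h'.choose_spec.trans h.symm)
  rw [weave, dif_pos h']
  simp only [this]

theorem weave_blank {j k : ℤ} (h : ∀ i, 4 * i + q (i, j) ≠ k) :
    weave e q x (j, k) = e none := by
  rw [weave, dif_neg]
  rintro ⟨i, hi⟩
  exact h i hi

theorem weave_ne_iff (hq : Lip q) {j k : ℤ} :
    weave e q x (j, k) ≠ e none ↔ ∃ i, 4 * i + q (i, j) = k := by
  constructor
  · intro h
    by_contra! h'
    exact h (weave_blank h')
  · rintro ⟨i, hi⟩
    simp [weave_knot hq hi]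

theorem eq_weave (hq : Lip q) {y : Config B}
    (h : ∀ i j, y (j, 4 * i + q (i, j)) = e (some (x (i, j))))
    (h' : ∀ j k, (∀ i, 4 * i + q (i, j) ≠ k) → y (j, k) = e none) : y = weave e q x := by
  funext ⟨j, k⟩
  by_cases hk : ∃ i, 4 * i + q (i, j) = k
  · obtain ⟨i, rfl⟩ := hk
    rw [h, weave_knot hq rfl]
  · rw [not_exists] at hk
    rw [h' j k hk, weave_blank hk]

/-- A constant may be traded between index and displacement: moving the index by `c` accounts for `4
c`, and the remainder `m` goes into `q`. As `m` is arbitrary, any translation can be realised with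
`c = 0`. -/
theorem shift_weave (hq : Lip q) (c d m : ℤ) :
    shift (d, 4 * c + m) (weave e q x) =
      weave e (fun u => shift (c, d) q u + m) (shift (c, d) x) := by
  refine eq_weave (hq.shift_add _ _) (fun i j => ?_) fun j k hk => ?_
  · simp only [shift_mk]
    rw [weave_knot hq]
    ring
  · simp only [shift_mk] at hk ⊢
    refine weave_blank fun i hi => hk (i + c) ?_
    rw [add_sub_cancel_right]
    linarith

theorem exists_weave_shift (hq : Lip q) (g : ℤ × ℤ) :
    ∃ q', Lip q' ∧ q' (0, 0) = 0 ∧ ∃ h, weave e q' (shift g x) = shift h (weave e q x) := by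
  obtain ⟨c, d⟩ := g
  exact ⟨_, hq.shift_add (c, d) (-(shift (c, d) q (0, 0))), by simp, _, (shift_weave hq c d _).symm⟩

theorem exists_reindex (hq : Lip q) (h : weave e q x (0, 0) ≠ e none) :
    ∃ c q', Lip q' ∧ q' (0, 0) = 0 ∧ weave e q x = weave e q' (shift (c, 0) x) := by
  obtain ⟨i, hi⟩ := (weave_ne_iff hq).1 h
  refine ⟨-i, _, hq.shift_add (-i, 0) (4 * i), ?_, ?_⟩
  · simpa [add_comm] using hi
  · rw [← shift_weave hq (-i) 0 (4 * i)]
    have : ((0 : ℤ), 4 * -i + 4 * i) = 0 := by ext <;> simp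
    rw [this, shift_zero]

theorem exists_le_knot (hq : Lip q) (j k : ℤ) :
    ∃ i, 4 * i + q (i, j) ≤ k ∧ k < 4 * (i + 1) + q (i + 1, j) := by
  obtain ⟨i, hi, hi'⟩ := Int.exists_greatest_of_bdd (P := fun i => 4 * i + q (i, j) ≤ k)
    ⟨(k - q (0, j)).natAbs, fun z hz => by have := hq 0 j z j; omega⟩
    ⟨-(k - q (0, j)).natAbs, by
      have := hq (-(k - q (0, j)).natAbs) j 0 j
      omega⟩
  refine ⟨i, hi, ?_⟩
  by_contra! h
  have := hi' (i + 1) h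
  omega

/-- The origin lies in a gap of length at most 5, so the last knot not above it has height between
-4 and 0; that knot receives the index 0. The bound confines the displacements to a compact set. -/
theorem exists_normalized (hq : Lip q) :
    ∃ c q', Lip q' ∧ (q' (0, 0)).natAbs ≤ 4 ∧ weave e q x = weave e q' (shift (c, 0) x) := by
  obtain ⟨i, hi, hi'⟩ := exists_le_knot hq 0 0
  refine ⟨-i, _, hq.shift_add (-i, 0) (4 * i), ?_, ?_⟩
  · have := hq (i + 1) 0 i 0
    simp only [shift_mk, sub_neg_eq_add, zero_add, sub_zero]
    omega
  · rw [← shift_weave hq (-i) 0 (4 * i)]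
    have : ((0 : ℤ), 4 * -i + 4 * i) = 0 := by ext <;> simp
    rw [this, shift_zero]

/-- A square of a weave depends only on a square of the data. -/
theorem agree_weave (hq : Lip q) (hq' : Lip q') {D R : ℕ} (hD : (q (0, 0)).natAbs ≤ D)
    (h : Agree (D + 2 * R) q q') (hx : Agree (D + 2 * R) x x') :
    Agree R (weave e q x) (weave e q' x') := by
  have h0 := h 0 0 (by simp) (by simp)
  intro j k hj hk
  by_cases hi : ∃ i, 4 * i + q (i, j) = k
  · obtain ⟨i, hi⟩ := hi
    -- From `4 i = k - q (i, j)` and `|q (i, j)| ≤ D + |i| + |j|` one gets `3 |i| ≤ D + 2 R`.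
    have hi' : i.natAbs ≤ D + 2 * R := by
      have := hq i j 0 0
      have := hq 0 0 i j
      omega
    rw [weave_knot hq hi, weave_knot hq' (i := i), hx i j hi' (by omega)]
    rw [← h i j hi' (by omega), hi]
  · rw [not_exists] at hi
    rw [weave_blank hi, weave_blank]
    intro i hi'
    have hi'' : i.natAbs ≤ D + 2 * R := by
      have := hq' i j 0 0
      have := hq' 0 0 i j
      omega
    exact hi i (by rw [h i j hi'' (by omega), hi'])

/-- In the adjacent column both weaves have their knot of index `i` within 1 of the common height.
These are at most 2 apart, while distinct knots of one column are at least 3 apart, so they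
coincide. -/
theorem knot_eq_of_vertical {r : ℕ} (hq : Lip q) (hq' : Lip q')
    (h : Agree (6 * r + 6) (weave e q x) (weave e q' x')) {i j j' : ℤ} (hjj : (j' - j).natAbs ≤ 1)
    (hj : j'.natAbs ≤ 6 * r + 6) (hk : (4 * i + q (i, j)).natAbs + 1 ≤ 6 * r + 6)
    (hqq : q (i, j) = q' (i, j)) : q (i, j') = q' (i, j') := by
  have h1 := hq i j' i j
  have h2 := hq i j i j'
  have h1' := hq' i j' i j
  have h2' := hq' i j i j'
  have h3 : weave e q x (j', 4 * i + q (i, j')) ≠ e none := (weave_ne_iff hq).2 ⟨i, rfl⟩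
  rw [h _ _ hj (by omega)] at h3
  obtain ⟨k, hk⟩ := (weave_ne_iff hq').1 h3
  have h4 := hq' i j' k j'
  have h5 := hq' k j' i j'
  have : k = i := by omega
  subst this
  omega

/-- The next knot of a column is 3 to 5 away and the one after it at least 6, so a position 3 to 5
away can only carry the next index. -/
theorem knot_eq_of_horizontal {r : ℕ} (hq : Lip q) (hq' : Lip q')
    (h : Agree (6 * r + 6) (weave e q x) (weave e q' x')) {i i' j : ℤ} (hii : (i' - i).natAbs ≤ 1)
    (hj : j.natAbs ≤ 6 * r + 6) (hk : (4 * i + q (i, j)).natAbs + 5 ≤ 6 * r + 6)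
    (hqq : q (i, j) = q' (i, j)) : q (i', j) = q' (i', j) := by
  have h1 := hq i' j i j
  have h2 := hq i j i' j
  have h1' := hq' i' j i j
  have h2' := hq' i j i' j
  have h3 : weave e q x (j, 4 * i' + q (i', j)) ≠ e none := (weave_ne_iff hq).2 ⟨i', rfl⟩
  have h3' : weave e q' x' (j, 4 * i' + q' (i', j)) ≠ e none := (weave_ne_iff hq').2 ⟨i', rfl⟩
  rw [h _ _ hj (by omega)] at h3
  rw [← h _ _ hj (by omega)] at h3'
  obtain ⟨k, hk⟩ := (weave_ne_iff hq').1 h3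
  obtain ⟨k', hk'⟩ := (weave_ne_iff hq).1 h3'
  have h4 := hq' i j k j
  have h5 := hq' k j i j
  have h4' := hq i j k' j
  have h5' := hq k' j i j
  have h6 := hq' i' j k j
  have h7 := hq' k j i' j
  have h6' := hq i' j k' j
  have h7' := hq k' j i' j
  omega

/-- Agreement of weaves near a common knot forces agreement of the woven configurations. -/
theorem agree_of_weave {r : ℕ} (hq : Lip q) (hq' : Lip q') (h0 : q (0, 0) = 0)
    (h0' : q' (0, 0) = 0) (h : Agree (6 * r + 6) (weave e q x) (weave e q' x')) :
    Agree r x x' := by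
  -- Starting at the common knot at the origin, equality of the displacements spreads along `i = 0`
  -- and then, for each `j`, along `i`. Knots with `|i|, |j| ≤ r` have height at most `4 r + 2 r`;
  -- this gives the window `6 r + 6`.
  have hcol : ∀ n : ℕ, n ≤ r → ∀ s : ℤ, s = 1 ∨ s = -1 →
      q (0, s * n) = q' (0, s * n) := by
    intro n
    induction n with
    | zero => intro _ s _; simp [h0, h0']
    | succ n ih =>
      intro hn s hs
      refine knot_eq_of_vertical hq hq' h (j := s * n) ?_ ?_ ?_ (ih (by omega) s hs)
      · rcases hs with rfl | rfl <;> push_cast <;> omega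
      · rcases hs with rfl | rfl <;> push_cast <;> omega
      · have := hq 0 (s * n) 0 0
        have := hq 0 0 0 (s * n)
        rcases hs with rfl | rfl <;> omega
  have hrow : ∀ j : ℤ, j.natAbs ≤ r → ∀ n : ℕ, n ≤ r → ∀ s : ℤ, s = 1 ∨ s = -1 →
      q (s * n, j) = q' (s * n, j) := by
    intro j hj n
    induction n with
    | zero =>
      intro _ s _
      rcases le_total 0 j with hj' | hj'
      · have := hcol j.natAbs hj 1 (Or.inl rfl)
        have hj2 : (1 : ℤ) * (j.natAbs : ℤ) = j := by omega
        rw [hj2] at this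
        simpa using this
      · have := hcol j.natAbs hj (-1) (Or.inr rfl)
        have hj2 : (-1 : ℤ) * (j.natAbs : ℤ) = j := by omega
        rw [hj2] at this
        simpa using this
    | succ n ih =>
      intro hn s hs
      refine knot_eq_of_horizontal hq hq' h (i := s * n) ?_ ?_ ?_ (ih (by omega) s hs)
      · rcases hs with rfl | rfl <;> push_cast <;> omega
      · omega
      · have := hq (s * n) j 0 0
        have := hq 0 0 (s * n) j
        rcases hs with rfl | rfl <;> omega
  intro i j hi hj
  have hqq : q (i, j) = q' (i, j) := by
    rcases le_total 0 i with hi' | hi'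
    · have := hrow j hj i.natAbs hi 1 (Or.inl rfl)
      have hi2 : (1 : ℤ) * (i.natAbs : ℤ) = i := by omega
      rwa [hi2] at this
    · have := hrow j hj i.natAbs hi (-1) (Or.inr rfl)
      have hi2 : (-1 : ℤ) * (i.natAbs : ℤ) = i := by omega
      rwa [hi2] at this
  have h1 := hq i j 0 0
  have h2 := hq 0 0 i j
  have := h j (4 * i + q (i, j)) (by omega) (by omega)
  rw [weave_knot hq rfl, weave_knot hq' (i := i) (by rw [hqq])] at this
  simpa using this

/-- Decoding: a weave that looks like `weave e q x` near a knot of the latter carries a shift of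
`x` near that knot. -/
theorem exists_agree_of_weave {r : ℕ} (hq : Lip q) (hq' : Lip q') (h0 : q (0, 0) = 0)
    (h : Agree (6 * r + 6) (weave e q' x') (weave e q x)) :
    ∃ g, Agree r (shift g x') x := by
  have hne : weave e q' x' (0, 0) ≠ e none := by
    rw [h 0 0 (by simp) (by simp)]
    exact (weave_ne_iff hq).2 ⟨0, by simpa using h0⟩
  obtain ⟨c, q'', hq'', h0'', hw⟩ := exists_reindex hq' hne
  rw [hw] at h
  exact ⟨_, agree_of_weave hq'' hq h0'' h0 h⟩

end Weave

/-! ### Orbit codings and their composition -/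

section Coding

variable {A B C : Type*}

theorem mem_setImage {f : Config A → Set (Config B)} {W : Set (Config A)} {y : Config B} :
    y ∈ setImage f W ↔ ∃ x ∈ W, y ∈ f x := by
  simp [setImage]

theorem setImage_setImage (f : Config A → Set (Config B)) (g : Config B → Set (Config C))
    (W : Set (Config A)) :
    setImage (fun x => setImage g (f x)) W = setImage g (setImage f W) := by
  ext z
  simp only [mem_setImage]
  grind

/-- The properties of a map from orbits to sets of orbits that are stable under composition:
it is injective on orbits, preserves subshifts, shifts of finite type, fully supported measures
and closures, and reflects transitivity pairs. -/
structure IsOrbitCoding [TopologicalSpace A] [TopologicalSpace B]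
    (f : Config A → Set (Config B)) : Prop where
  congr : ∀ x x', orbit x = orbit x' → f x = f x'
  nonempty : ∀ x, (f x).Nonempty
  orbit_subset : ∀ x, ∀ y ∈ f x, orbit y ⊆ f x
  orbit_eq : ∀ x x' y, y ∈ f x → y ∈ f x' → orbit x = orbit x'
  isSubshift : ∀ W, IsSubshift W → IsSubshift (setImage f W)
  isSFT : ∀ W, IsSFT W → IsSFT (setImage f W)
  measure : ∀ W, IsSubshift W → HasFullySupportedMeasure W →
    HasFullySupportedMeasure (setImage f W)
  closure_iff : ∀ S, ShiftInvariant S → ∀ x, x ∈ closure S ↔ f x ⊆ closure (setImage f S)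
  reflects : ∀ W, ShiftInvariant W → ∀ x ∈ W, ∀ x' ∈ W, ∀ y ∈ f x, ∀ y' ∈ f x',
    IsTransitivityPair (setImage f W) y y' → IsTransitivityPair W x x'

theorem shiftInvariant_setImage {f : Config A → Set (Config B)}
    (hf : ∀ x, ∀ y ∈ f x, orbit y ⊆ f x) (W : Set (Config A)) :
    ShiftInvariant (setImage f W) := by
  intro g y hy
  obtain ⟨x, hx, hxy⟩ := mem_setImage.1 hy
  exact mem_setImage.2 ⟨x, hx, hf x y hxy (shift_mem_orbit g y)⟩

theorem IsOrbitCoding.comp [TopologicalSpace A] [TopologicalSpace B] [TopologicalSpace C]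
    {g : Config B → Set (Config C)} {f : Config A → Set (Config B)}
    (hg : IsOrbitCoding g) (hf : IsOrbitCoding f) :
    IsOrbitCoding fun x => setImage g (f x) where
  congr x x' h := by rw [hf.congr x x' h]
  nonempty x := by
    obtain ⟨y, hy⟩ := hf.nonempty x
    obtain ⟨z, hz⟩ := hg.nonempty y
    exact ⟨z, mem_setImage.2 ⟨y, hy, hz⟩⟩
  orbit_subset x z hz := by
    obtain ⟨y, hy, hyz⟩ := mem_setImage.1 hz
    exact fun w hw => mem_setImage.2 ⟨y, hy, hg.orbit_subset y z hyz hw⟩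
  orbit_eq x x' z hz hz' := by
    obtain ⟨y, hy, hyz⟩ := mem_setImage.1 hz
    obtain ⟨y', hy', hyz'⟩ := mem_setImage.1 hz'
    have h : orbit y' = orbit y := hg.orbit_eq y' y z hyz' hyz
    exact hf.orbit_eq x x' y hy (hf.orbit_subset x' y' hy' (h ▸ mem_orbit_self y))
  isSubshift W hW := by
    rw [setImage_setImage]
    exact hg.isSubshift _ (hf.isSubshift W hW)
  isSFT W hW := by
    rw [setImage_setImage]
    exact hg.isSFT _ (hf.isSFT W hW)
  measure W hW hm := by
    rw [setImage_setImage]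
    exact hg.measure _ (hf.isSubshift W hW) (hf.measure W hW hm)
  closure_iff S hS x := by
    rw [setImage_setImage, hf.closure_iff S hS x]
    have := hg.closure_iff (setImage f S) (shiftInvariant_setImage hf.orbit_subset S)
    simp only [Set.subset_def, mem_setImage, forall_exists_index, and_imp]
    refine ⟨fun h z y hy hz => (this y).1 (h y hy) hz, fun h y hy => (this y).2 fun z hz => ?_⟩
    exact h z y hy hz
  reflects W hW x hx x' hx' z hz z' hz' h := by
    obtain ⟨y, hy, hyz⟩ := mem_setImage.1 hz
    obtain ⟨y', hy', hyz'⟩ := mem_setImage.1 hz'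
    rw [setImage_setImage] at h
    exact hf.reflects W hW x hx x' hx' y hy y' hy'
      (hg.reflects _ (shiftInvariant_setImage hf.orbit_subset W) y
        (mem_setImage.2 ⟨x, hx, hy⟩) y' (mem_setImage.2 ⟨x', hx', hy'⟩) z hyz z' hyz' h)

end Coding

/-! ### The fabric of a configuration -/

section Fabric

variable {A B : Type*} {e : Option A ≃ B}

/-- All weaves of points of the orbit of `x`. -/
def fabric (e : Option A ≃ B) (x : Config A) : Set (Config B) :=
  {y | ∃ x' ∈ orbit x, ∃ q, Lip q ∧ weave e q x' = y}

theorem lip_zero : Lip fun _ => 0 := fun i j i' j' => by simp; positivity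

theorem weave_mem_fabric {x x' : Config A} (hx : x' ∈ orbit x) {q : Config ℤ} (hq : Lip q) :
    weave e q x' ∈ fabric e x :=
  ⟨x', hx, q, hq, rfl⟩

theorem mem_setImage_fabric {W : Set (Config A)} (hW : ShiftInvariant W) {y : Config B} :
    y ∈ setImage (fabric e) W ↔ ∃ x ∈ W, ∃ q, Lip q ∧ weave e q x = y := by
  rw [mem_setImage]
  constructor
  · rintro ⟨x, hx, x', hx', q, hq, rfl⟩
    exact ⟨x', hW.orbit_subset hx hx', q, hq, rfl⟩
  · rintro ⟨x, hx, q, hq, rfl⟩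
    exact ⟨x, hx, weave_mem_fabric (mem_orbit_self x) hq⟩

theorem fabric_congr {x x' : Config A} (h : orbit x = orbit x') : fabric e x = fabric e x' := by
  simp only [fabric, h]

theorem fabric_nonempty (x : Config A) : (fabric e x).Nonempty :=
  ⟨_, weave_mem_fabric (mem_orbit_self x) lip_zero⟩

theorem orbit_subset_fabric (x : Config A) : ∀ y ∈ fabric e x, orbit y ⊆ fabric e x := by
  rintro _ ⟨x', hx', q, hq, rfl⟩ _ ⟨⟨d, n⟩, rfl⟩
  have := shift_weave (e := e) (x := x') hq 0 d n
  simp only [mul_zero, zero_add] at this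
  simp only [this]
  refine weave_mem_fabric ?_ (hq.shift_add _ _)
  rw [← orbit_eq_of_mem hx']
  exact shift_mem_orbit _ _

theorem orbit_eq_of_mem_fabric (x x' : Config A) (y : Config B) (h : y ∈ fabric e x)
    (h' : y ∈ fabric e x') : orbit x = orbit x' := by
  obtain ⟨x₁, hx₁, q, hq, rfl⟩ := h
  obtain ⟨x₂, hx₂, q', hq', hy⟩ := h'
  rw [← orbit_eq_of_mem hx₁, ← orbit_eq_of_mem hx₂]
  obtain ⟨q₁, hq₁, h0, g, hg⟩ := exists_weave_shift (e := e) (x := x₁) hq 0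
  rw [shift_zero, ← hy] at hg
  obtain ⟨d, n⟩ := g
  have hs := shift_weave (e := e) (x := x₂) hq' 0 d n
  simp only [mul_zero, zero_add] at hs
  rw [hs] at hg
  obtain ⟨c, q₂, hq₂, h0', hw⟩ := exists_reindex (e := e) (x := shift (0, d) x₂)
    (hq'.shift_add (0, d) n) (by
      rw [← hg]
      exact (weave_ne_iff hq₁).2 ⟨0, by simpa using h0⟩)
  rw [hw] at hg
  have : x₁ = shift (c, 0) (shift (0, d) x₂) := by
    funext ⟨i, j⟩
    refine agree_of_weave (e := e) (r := i.natAbs + j.natAbs) hq₁ hq₂ h0 h0' ?_ i j (by omega) (by omega)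
    rw [hg]
    exact Agree.refl _ _
  rw [this, orbit_shift, orbit_shift]

/-- Each weave is recentred at the knot carrying the desired place of `x` or `x'`. A point showing
both recentred windows is itself a weave of some `z ∈ W`, and decoding it at the two places finds
both windows in `z`. -/
theorem reflects_fabric (W : Set (Config A)) (hW : ShiftInvariant W) (x : Config A) (hx : x ∈ W)
    (x' : Config A) (hx' : x' ∈ W) (y : Config B) (hy : y ∈ fabric e x) (y' : Config B)
    (hy' : y' ∈ fabric e x') (h : IsTransitivityPair (setImage (fabric e) W) y y') :
    IsTransitivityPair W x x' := by
  obtain ⟨_, ⟨k₁, rfl⟩, q₁, hq₁, rfl⟩ := hy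
  obtain ⟨_, ⟨k₂, rfl⟩, q₂, hq₂, rfl⟩ := hy'
  refine isTransitivityPair_of_agree hx hx' fun r g g' => ?_
  obtain ⟨p₁, hp₁, h₁, a₁, ha₁⟩ := exists_weave_shift (e := e) (x := shift k₁ x) hq₁ (g - k₁)
  obtain ⟨p₂, hp₂, h₂, a₂, ha₂⟩ := exists_weave_shift (e := e) (x := shift k₂ x') hq₂ (g' - k₂)
  rw [shift_shift, sub_add_cancel] at ha₁ ha₂
  obtain ⟨z, hz, hz₁, hz₂⟩ := h.2.2 _ _
    (appearsIn_shift_iff.1 (ha₁ ▸ window_appearsIn_self (6 * r + 6) (weave e p₁ (shift g x))))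
    (appearsIn_shift_iff.1 (ha₂ ▸ window_appearsIn_self (6 * r + 6) (weave e p₂ (shift g' x'))))
  obtain ⟨z, hzW, q, hq, rfl⟩ := (mem_setImage_fabric hW).1 hz
  obtain ⟨b₁, hb₁⟩ := window_appearsIn_iff.1 hz₁
  obtain ⟨b₂, hb₂⟩ := window_appearsIn_iff.1 hz₂
  have key : ∀ (b : ℤ × ℤ) (p : Config ℤ) (w : Config A), Lip p → p (0, 0) = 0 →
      Agree (6 * r + 6) (shift b (weave e q z)) (weave e p w) → ∃ k, Agree r (shift k z) w := by
    rintro ⟨d, n⟩ p w hp h0 hb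
    have hs := shift_weave (e := e) (x := z) hq 0 d n
    simp only [mul_zero, zero_add] at hs
    rw [hs] at hb
    obtain ⟨k, hk⟩ := exists_agree_of_weave hp (hq.shift_add _ _) h0 hb
    rw [shift_shift] at hk
    exact ⟨_, hk⟩
  obtain ⟨k, hk⟩ := key b₁ p₁ _ hp₁ h₁ (ha₁ ▸ hb₁)
  obtain ⟨k', hk'⟩ := key b₂ p₂ _ hp₂ h₂ (ha₂ ▸ hb₂)
  exact ⟨z, hzW, k, k', hk, hk'⟩

variable [TopologicalSpace A] [DiscreteTopology A] [TopologicalSpace B] [DiscreteTopology B]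

theorem continuousOn_weave (e : Option A ≃ B) :
    ContinuousOn (fun p : Config ℤ × Config A => weave e p.1 p.2) {p | Lip p.1} := by
  intro p hp
  refine (nhds_hasBasis_agree _).tendsto_right_iff.2 fun R _ => ?_
  have h1 : ∀ᶠ p' : Config ℤ × Config A in 𝓝 p,
      Agree ((p.1 (0, 0)).natAbs + 2 * R) p'.1 p.1 :=
    continuous_fst.tendsto p ((nhds_hasBasis_agree p.1).mem_of_mem trivial)
  have h2 : ∀ᶠ p' : Config ℤ × Config A in 𝓝 p,
      Agree ((p.1 (0, 0)).natAbs + 2 * R) p'.2 p.2 :=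
    continuous_snd.tendsto p ((nhds_hasBasis_agree p.2).mem_of_mem trivial)
  filter_upwards [mem_nhdsWithin_of_mem_nhds h1, mem_nhdsWithin_of_mem_nhds h2,
    self_mem_nhdsWithin] with p' h1' h2' hp'
  exact (agree_weave hp hp' le_rfl h1'.symm h2'.symm).symm

theorem continuous_weave (e : Option A ≃ B) {q : Config ℤ} (hq : Lip q) :
    Continuous (weave e q) :=
  (continuousOn_weave e).comp_continuous (f := fun x => (q, x)) (by fun_prop) fun _ => hq

theorem isCompact_lip (D : ℕ) : IsCompact {q : Config ℤ | Lip q ∧ (q (0, 0)).natAbs ≤ D} := by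
  have hc : IsCompact (Set.pi univ fun u : ℤ × ℤ =>
      Icc (-(D + u.1.natAbs + u.2.natAbs : ℤ)) (D + u.1.natAbs + u.2.natAbs)) :=
    isCompact_univ_pi fun u => isCompact_Icc
  refine hc.of_isClosed_subset ?_ ?_
  · have : {q : Config ℤ | Lip q} = ⋂ (i : ℤ) (j : ℤ) (i' : ℤ) (j' : ℤ),
        {q : Config ℤ | q (i, j) ≤
          q (i', j') + ((i - i').natAbs : ℤ) + ((j - j').natAbs : ℤ)} := by
      ext q
      simp [Lip]
    refine IsClosed.inter (s₁ := {q : Config ℤ | Lip q}) ?_ ?_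
    · rw [this]
      refine isClosed_iInter fun i => isClosed_iInter fun j => isClosed_iInter fun i' =>
        isClosed_iInter fun j' => isClosed_le (by fun_prop) (by fun_prop)
    · exact (isClosed_discrete {k : ℤ | k.natAbs ≤ D}).preimage
        (f := fun q : Config ℤ => q (0, 0)) (by fun_prop)
  · rintro q ⟨hq, h0⟩ ⟨i, j⟩ -
    have := hq i j 0 0
    have := hq 0 0 i j
    simp only [mem_Icc]
    omega

/-- Normalized displacements suffice, so the image is that of a compact set of pairs under a map
continuous on it. -/
theorem isSubshift_fabric [Finite A] (W : Set (Config A)) (hW : IsSubshift W) :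
    IsSubshift (setImage (fabric e) W) := by
  refine ⟨?_, shiftInvariant_setImage orbit_subset_fabric W⟩
  have : setImage (fabric e) W = (fun p : Config ℤ × Config A => weave e p.1 p.2) ''
      ({q | Lip q ∧ (q (0, 0)).natAbs ≤ 4} ×ˢ W) := by
    ext y
    rw [mem_setImage_fabric hW.2]
    constructor
    · rintro ⟨x, hx, q, hq, rfl⟩
      obtain ⟨c, q', hq', h0, hw⟩ := exists_normalized (e := e) (x := x) hq
      exact ⟨(q', shift (c, 0) x), ⟨⟨hq', h0⟩, hW.2 _ _ hx⟩, hw.symm⟩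
    · rintro ⟨⟨q, x⟩, ⟨⟨hq, -⟩, hx⟩, rfl⟩
      exact ⟨x, hx, q, hq, rfl⟩
  rw [this]
  exact (((isCompact_lip 4).prod hW.1.isCompact).image_of_continuousOn
    ((continuousOn_weave e).mono fun p hp => hp.1.1)).isClosed

theorem closure_iff_fabric (S : Set (Config A)) (hS : ShiftInvariant S) (x : Config A) :
    x ∈ closure S ↔ fabric e x ⊆ closure (setImage (fabric e) S) := by
  constructor
  · rintro hx _ ⟨_, ⟨g, rfl⟩, q, hq, rfl⟩
    have h1 : shift g x ∈ closure S :=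
      map_mem_closure (continuous_shift g) hx fun y hy => hS g y hy
    refine map_mem_closure (continuous_weave e hq) h1 fun y hy => ?_
    exact (mem_setImage_fabric hS).2 ⟨y, hy, q, hq, rfl⟩
  · intro h
    refine mem_closure_iff_agree.2 fun r => ?_
    -- A single point of the fabric is enough here; the zero displacement puts a knot at the origin,
    -- where decoding starts.
    obtain ⟨y, hy, hr⟩ := mem_closure_iff_agree.1
      (h (weave_mem_fabric (mem_orbit_self x) lip_zero)) (6 * r + 6)
    obtain ⟨z, hz, q, hq, rfl⟩ := (mem_setImage_fabric hS).1 hy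
    obtain ⟨g, hg⟩ := exists_agree_of_weave lip_zero hq rfl hr
    exact ⟨_, hS g z hz, hg⟩

end Fabric

/-! ### Fabrics of shifts of finite type -/

section FiniteType

variable {A B : Type*} {e : Option A ≃ B}

theorem le_add_natAbs_of_step {f : ℤ → ℤ} (hf : ∀ i, (f (i + 1) - f i).natAbs ≤ 1) (i i' : ℤ) :
    f i ≤ f i' + (i - i').natAbs := by
  have key : ∀ (n : ℕ) (a : ℤ), f (a + n) ≤ f a + n ∧ f a ≤ f (a + n) + n := by
    intro n a
    induction n with
    | zero => simp
    | succ n ih =>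
      have := hf (a + n)
      push_cast
      rw [← add_assoc]
      omega
  rcases le_total i i' with h | h
  · have := (key (i - i').natAbs i).2
    rwa [show i + ((i - i').natAbs : ℤ) = i' by omega] at this
  · have := (key (i - i').natAbs i').1
    rwa [show i' + ((i - i').natAbs : ℤ) = i by omega] at this

theorem lip_of_step {q : Config ℤ} (h : ∀ i j, (q (i + 1, j) - q (i, j)).natAbs ≤ 1)
    (h' : ∀ i j, (q (i, j + 1) - q (i, j)).natAbs ≤ 1) : Lip q := by
  intro i j i' j'
  have h1 := le_add_natAbs_of_step (f := fun a => q (a, j)) (fun a => h a j) i i'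
  have h2 := le_add_natAbs_of_step (f := fun a => q (i', a)) (fun a => h' i' a) j j'
  omega

theorem exists_perm_of_existsUnique {α : Type*} {R : α → α → Prop}
    (h : ∀ u, ∃! v, R u v) (h' : ∀ v, ∃! u, R u v) :
    ∃ σ : Equiv.Perm α, ∀ u v, R u v ↔ σ u = v := by
  choose f hf hf' using h
  have hR : ∀ u v, R u v ↔ f u = v := fun u v => ⟨fun h => (hf' u v h).symm, fun h => h ▸ hf u⟩
  have hb : Function.Bijective f := by
    refine ⟨fun u v huv => ?_, fun v => ?_⟩
    · exact (h' (f u)).unique (hf u) (huv ▸ hf v)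
    · obtain ⟨u, hu, -⟩ := h' v
      exact ⟨u, (hR u v).1 hu⟩
  exact ⟨Equiv.ofBijective f hb, hR⟩

/-- Near each of its knots, `y` looks like a weave. -/
def LocallyWoven (e : Option A ≃ B) (y : Config B) : Prop :=
  ∀ a b, y (a, b) ≠ e none → ∃ q, Lip q ∧ q (0, 0) = 0 ∧ ∀ j k : ℤ, j.natAbs ≤ 6 → k.natAbs ≤ 6 →
    (y (a + j, b + k) ≠ e none ↔ ∃ i, 4 * i + q (i, j) = k)

variable {y : Config B}

/-- The permutation `σ` moves to the next knot of the column and `τ` to the neighbouring knot in the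
next column. They commute because the local weave also contains the knot of index `(1, 1)`, reached
both ways; its height is at most `4 + 2`, which is why radius 6 is used. -/
theorem LocallyWoven.exists_perms (hy : LocallyWoven e y) :
    ∃ σ τ : Equiv.Perm {u : ℤ × ℤ // y u ≠ e none}, Commute σ τ ∧
      (∀ u v, σ u = v ↔ v.1.1 = u.1.1 ∧ u.1.2 + 3 ≤ v.1.2 ∧ v.1.2 ≤ u.1.2 + 5) ∧
      ∀ u v, τ u = v ↔ v.1.1 = u.1.1 + 1 ∧ u.1.2 ≤ v.1.2 + 1 ∧ v.1.2 ≤ u.1.2 + 1 := by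
  let P := {u : ℤ × ℤ // y u ≠ e none}
  let R : P → P → Prop := fun u v => v.1.1 = u.1.1 ∧ u.1.2 + 3 ≤ v.1.2 ∧ v.1.2 ≤ u.1.2 + 5
  let T : P → P → Prop := fun u v => v.1.1 = u.1.1 + 1 ∧ u.1.2 ≤ v.1.2 + 1 ∧ v.1.2 ≤ u.1.2 + 1
  have hR : ∀ u, ∃! v, R u v := by
    rintro ⟨⟨a, b⟩, hu⟩
    obtain ⟨q, hq, h0, h⟩ := hy a b hu
    have h1 := hq 1 0 0 0
    have h2 := hq 0 0 1 0
    refine ⟨⟨(a + 0, b + (4 * 1 + q (1, 0))), (h _ _ (by omega) (by omega)).2 ⟨1, rfl⟩⟩,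
      ⟨by simp, by dsimp only; omega, by dsimp only; omega⟩, ?_⟩
    rintro ⟨⟨a', b'⟩, hv⟩ ⟨h3, h4, h5⟩
    dsimp only at h3 h4 h5
    obtain ⟨i, hi⟩ := (h 0 (b' - b) (by omega) (by omega)).1
      (by rw [add_zero, add_sub_cancel, ← h3]; exact hv)
    have h6 := hq i 0 0 0
    have h7 := hq 0 0 i 0
    have : i = 1 := by omega
    subst this
    ext <;> dsimp only <;> omega
  have hR' : ∀ v, ∃! u, R u v := by
    rintro ⟨⟨a, b⟩, hu⟩
    obtain ⟨q, hq, h0, h⟩ := hy a b hu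
    have h1 := hq (-1) 0 0 0
    have h2 := hq 0 0 (-1) 0
    refine ⟨⟨(a + 0, b + (4 * (-1) + q (-1, 0))), (h _ _ (by omega) (by omega)).2 ⟨-1, rfl⟩⟩,
      ⟨by simp, by dsimp only; omega, by dsimp only; omega⟩, ?_⟩
    rintro ⟨⟨a', b'⟩, hv⟩ ⟨h3, h4, h5⟩
    dsimp only at h3 h4 h5
    obtain ⟨i, hi⟩ := (h 0 (b' - b) (by omega) (by omega)).1
      (by rw [add_zero, add_sub_cancel, h3]; exact hv)
    have h6 := hq i 0 0 0
    have h7 := hq 0 0 i 0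
    have : i = -1 := by omega
    subst this
    ext <;> dsimp only <;> omega
  have hT : ∀ u, ∃! v, T u v := by
    rintro ⟨⟨a, b⟩, hu⟩
    obtain ⟨q, hq, h0, h⟩ := hy a b hu
    have h1 := hq 0 1 0 0
    have h2 := hq 0 0 0 1
    refine ⟨⟨(a + 1, b + (4 * 0 + q (0, 1))), (h _ _ (by omega) (by omega)).2 ⟨0, rfl⟩⟩,
      ⟨by simp, by dsimp only; omega, by dsimp only; omega⟩, ?_⟩
    rintro ⟨⟨a', b'⟩, hv⟩ ⟨h3, h4, h5⟩
    dsimp only at h3 h4 h5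
    obtain ⟨i, hi⟩ := (h 1 (b' - b) (by omega) (by omega)).1
      (by rw [add_sub_cancel, ← h3]; exact hv)
    have h6 := hq i 1 0 0
    have h7 := hq 0 0 i 1
    have : i = 0 := by omega
    subst this
    ext <;> dsimp only <;> omega
  have hT' : ∀ v, ∃! u, T u v := by
    rintro ⟨⟨a, b⟩, hu⟩
    obtain ⟨q, hq, h0, h⟩ := hy a b hu
    have h1 := hq 0 (-1) 0 0
    have h2 := hq 0 0 0 (-1)
    refine ⟨⟨(a + (-1), b + (4 * 0 + q (0, -1))), (h _ _ (by omega) (by omega)).2 ⟨0, rfl⟩⟩,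
      ⟨by simp, by dsimp only; omega, by dsimp only; omega⟩, ?_⟩
    rintro ⟨⟨a', b'⟩, hv⟩ ⟨h3, h4, h5⟩
    dsimp only at h3 h4 h5
    obtain ⟨i, hi⟩ := (h (-1) (b' - b) (by omega) (by omega)).1
      (by rw [add_sub_cancel, h3, add_neg_cancel_right]; exact hv)
    have h6 := hq i (-1) 0 0
    have h7 := hq 0 0 i (-1)
    have : i = 0 := by omega
    subst this
    ext <;> dsimp only <;> omega
  obtain ⟨σ, hσ⟩ := exists_perm_of_existsUnique hR hR'
  obtain ⟨τ, hτ⟩ := exists_perm_of_existsUnique hT hT'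
  refine ⟨σ, τ, Equiv.ext ?_, fun u v => (hσ u v).symm, fun u v => (hτ u v).symm⟩
  rintro ⟨⟨a, b⟩, hu⟩
  obtain ⟨q, hq, h0, h⟩ := hy a b hu
  have h1 := hq 1 0 0 0
  have h2 := hq 0 0 1 0
  have h3 := hq 0 1 0 0
  have h4 := hq 0 0 0 1
  have h5 := hq 1 1 0 1
  have h6 := hq 0 1 1 1
  have h7 := hq 1 0 1 1
  have h8 := hq 1 1 1 0
  let v₁ : P := ⟨(a + 0, b + (4 * 1 + q (1, 0))), (h _ _ (by omega) (by omega)).2 ⟨1, rfl⟩⟩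
  let v₂ : P := ⟨(a + 1, b + (4 * 0 + q (0, 1))), (h _ _ (by omega) (by omega)).2 ⟨0, rfl⟩⟩
  let w : P := ⟨(a + 1, b + (4 * 1 + q (1, 1))), (h _ _ (by omega) (by omega)).2 ⟨1, rfl⟩⟩
  have e1 : σ ⟨(a, b), hu⟩ = v₁ := (hσ _ _).1 (by simp only [R, v₁]; omega)
  have e2 : τ ⟨(a, b), hu⟩ = v₂ := (hτ _ _).1 (by simp only [T, v₂]; refine ⟨trivial, ?_⟩; omega)
  have e3 : σ v₂ = w := (hσ _ _).1 (by simp only [R, w, v₂]; refine ⟨trivial, ?_⟩; omega)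
  have e4 : τ v₁ = w := (hτ _ _).1 (by simp only [T, w, v₁]; omega)
  simp only [Equiv.Perm.mul_apply, e1, e2, e3, e4]

/-- The commuting permutations give an action of `ℤ²` on the knots, and the orbit of one knot
supplies the indices. The bounds on single steps make the resulting displacement Lipschitz. The
all-blank configuration is locally woven vacuously and has to be excluded. -/
theorem LocallyWoven.exists_eq_weave (hy : LocallyWoven e y) (hne : ∃ u, y u ≠ e none) :
    ∃ q x, Lip q ∧ y = weave e q x := by
  obtain ⟨u₀, hu₀⟩ := hne
  obtain ⟨σ, τ, hc, hσ, hτ⟩ := hy.exists_perms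
  let kn : ℤ → ℤ → {u : ℤ × ℤ // y u ≠ e none} := fun i j => (τ ^ (j - u₀.1)) ((σ ^ i) ⟨u₀, hu₀⟩)
  have hkσ : ∀ i j, kn (i + 1) j = σ (kn i j) := by
    intro i j
    have : τ ^ (j - u₀.1) * σ ^ (i + 1) = σ * (τ ^ (j - u₀.1) * σ ^ i) := by
      rw [add_comm, zpow_add, zpow_one, ← mul_assoc, ← mul_assoc, (hc.zpow_right _).eq]
    exact congrArg (fun π : Equiv.Perm _ => π ⟨u₀, hu₀⟩) this
  have hkτ : ∀ i j, kn i (j + 1) = τ (kn i j) := by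
    intro i j
    simp only [kn]
    rw [show j + 1 - u₀.1 = 1 + (j - u₀.1) by ring, zpow_add, zpow_one, Equiv.Perm.mul_apply]
  have s1 := fun i j => (hσ (kn i j) (kn (i + 1) j)).1 (hkσ i j).symm
  have s2 := fun i j => (hτ (kn i j) (kn i (j + 1))).1 (hkτ i j).symm
  have hj : ∀ i j, (kn i j).1.1 = j := by
    have h0 : ∀ i, (kn i u₀.1).1.1 = u₀.1 := by
      intro i
      induction i using Int.induction_on with
      | zero => simp [kn]
      | succ i ih => rw [(s1 i _).1, ih]
      | pred i ih =>
        have := (s1 (-i - 1) u₀.1).1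
        rw [sub_add_cancel, ih] at this
        exact this.symm
    intro i j
    have h1 : ∀ n : ℤ, (kn i (u₀.1 + n)).1.1 = u₀.1 + n := by
      intro n
      induction n using Int.induction_on with
      | zero => simpa using h0 i
      | succ n ih => rw [← add_assoc, (s2 i _).1, ih]
      | pred n ih =>
        have := (s2 i (u₀.1 + (-n - 1))).1
        rw [show u₀.1 + (-(n : ℤ) - 1) + 1 = u₀.1 + -n by ring, ih] at this
        omega
    simpa using h1 (j - u₀.1)
  have hsome : ∀ u : {u : ℤ × ℤ // y u ≠ e none}, ∃ a, y u = e (some a) := by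
    rintro ⟨u, hu⟩
    cases h : e.symm (y u) with
    | none => exact absurd ((Equiv.symm_apply_eq e).1 h) hu
    | some a => exact ⟨a, (Equiv.symm_apply_eq e).1 h⟩
  choose s hs using hsome
  let q : Config ℤ := fun u => (kn u.1 u.2).1.2 - 4 * u.1
  have hq : Lip q := by
    refine lip_of_step (fun i j => ?_) fun i j => ?_
    · have := s1 i j
      simp only [q]
      omega
    · have := s2 i j
      simp only [q]
      omega
  refine ⟨q, fun u => s (kn u.1 u.2), hq, eq_weave hq (fun i j => ?_) fun j k hk => ?_⟩
  · rw [← hs]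
    congr 1
    ext
    · exact (hj i j).symm
    · simp [q]
  -- A knot outside the indexed family would lie strictly between two consecutive indexed ones. The
  -- gap being at most 5, it would satisfy the condition characterising `σ (kn i j)`, so it would be
  -- the upper one.
  · by_contra hne
    obtain ⟨i, hi, hi'⟩ := exists_le_knot hq j k
    have hi1 := hk i
    have hi2 := hk (i + 1)
    simp only [q] at hi hi' hi1 hi2
    have h5 := s1 i j
    have hkn : y (j, (kn i j).1.2) ≠ e none := by
      have := (kn i j).2
      rwa [← Prod.mk.eta (p := (kn i j).1), hj] at this
    obtain ⟨p, hp, h0, h⟩ := hy j (kn i j).1.2 hkn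
    obtain ⟨i', hi''⟩ := (h 0 (k - (kn i j).1.2) (by omega) (by omega)).1
      (by rwa [add_zero, add_sub_cancel])
    have h6 := hp i' 0 0 0
    have h7 := hp 0 0 i' 0
    have h8 : σ (kn i j) = ⟨(j, k), hne⟩ :=
      (hσ _ _).2 ⟨(hj i j).symm, by dsimp only; omega, by dsimp only; omega⟩
    rw [← hkσ] at h8
    apply hi2
    rw [h8]
    ring

/-- The forbidden patterns are the windows of radius `6 r + 6` never seen in the fabric, with `r`
large enough for every forbidden shape of `W`. Avoiding them forces a global weave. A forbidden
pattern in the woven configuration would be decoded from a window that also occurs over some point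
of `W`. -/
theorem isSFT_fabric [Finite B] (W : Set (Config A)) (hW : IsSFT W) :
    IsSFT (setImage (fabric e) W) := by
  obtain ⟨F, hF, rfl⟩ := hW
  have hinv := shiftInvariant_avoiding F
  obtain ⟨r, hr⟩ : ∃ r : ℕ, ∀ w ∈ F, ∀ s ∈ w.shape, s.1.natAbs ≤ r ∧ s.2.natAbs ≤ r := by
    classical
    obtain ⟨r, hr⟩ := exists_natAbs_le (hF.toFinset.biUnion Pattern.shape)
    exact ⟨r, fun w hw s hs => hr s (Finset.mem_biUnion.2 ⟨w, hF.mem_toFinset.2 hw, hs⟩)⟩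
  let X := setImage (fabric e) (avoiding F)
  have hX : ShiftInvariant X := shiftInvariant_setImage orbit_subset_fabric _
  let N := 6 * r + 6
  refine ⟨{w | w ∈ range (window N) ∧ ∀ z ∈ X, ¬ w.AppearsIn z}, ?_, ?_⟩
  · refine (Set.finite_range fun s : square N → B => (⟨square N, s⟩ : Pattern B)).subset ?_
    rintro _ ⟨⟨x, rfl⟩, -⟩
    exact ⟨_, rfl⟩
  refine Subset.antisymm (fun y hy w hw => hw.2 y hy) fun y hy => ?_
  have hloc : ∀ g, ∃ x ∈ avoiding F, ∃ q, Lip q ∧ Agree N (weave e q x) (shift g y) := by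
    intro g
    by_contra! hcon
    refine hy (window N (shift g y)) ⟨⟨_, rfl⟩, fun z hz happ => ?_⟩
      (appearsIn_shift_iff.1 (window_appearsIn_self N _))
    obtain ⟨h, hh⟩ := window_appearsIn_iff.1 happ
    obtain ⟨x, hx, q, hq, hxq⟩ := (mem_setImage_fabric hinv).1 (hX h z hz)
    exact hcon x hx q hq (hxq ▸ hh)
  have hwoven : LocallyWoven e y := by
    intro a b hab
    obtain ⟨x, -, q, hq, hag⟩ := hloc (-a, -b)
    obtain ⟨c, q', hq', h0, hw⟩ := exists_reindex (e := e) (x := x) hq (by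
      rw [hag 0 0 (by simp) (by simp)]
      simpa using hab)
    refine ⟨q', hq', h0, fun j k hj hk => ?_⟩
    rw [← weave_ne_iff (e := e) (x := shift (c, 0) x) hq', ← hw, hag j k (by omega) (by omega)]
    simp [add_comm]
  -- The window at the origin is that of a weave, whose gaps are too short for the window to be
  -- blank.
  obtain ⟨q, x, hq, rfl⟩ := hwoven.exists_eq_weave (by
    obtain ⟨x, -, q, hq, hag⟩ := hloc 0
    obtain ⟨i, hi, hi'⟩ := exists_le_knot hq 0 0
    have h1 := hq (i + 1) 0 i 0
    have h2 := hag 0 (4 * i + q (i, 0)) (by simp) (by omega)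
    rw [shift_zero] at h2
    exact ⟨_, h2 ▸ (weave_ne_iff hq).2 ⟨i, rfl⟩⟩)
  refine (mem_setImage_fabric hinv).2 ⟨x, ?_, q, hq, rfl⟩
  rintro w hw ⟨g, hg⟩
  obtain ⟨q', hq', h0, h, hh⟩ := exists_weave_shift (e := e) (x := x) hq g
  obtain ⟨x₀, hx₀, q₀, hq₀, hag⟩ := hloc h
  rw [← hh] at hag
  obtain ⟨k, hk⟩ := exists_agree_of_weave hq' hq₀ h0 hag
  refine hx₀ w hw ⟨k, fun s => ?_⟩
  rw [← hg s]
  exact hk _ _ (hr w hw s s.2).1 (hr w hw s s.2).2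

end FiniteType

/-! ### Cutting off and glueing Lipschitz displacements -/

section Glue

/-- The displacement is clamped between `-φ` and `φ` for a Lipschitz cone `φ` of height `D + 4 r`.
On the square `|q| ≤ D + 2 r ≤ φ`, so nothing changes there. -/
theorem Lip.exists_cutoff {q : Config ℤ} (hq : Lip q) {D : ℕ} (hD : (q (0, 0)).natAbs ≤ D)
    (r : ℕ) : ∃ b, Lip b ∧ (∀ i j : ℤ, D + 4 * r ≤ i.natAbs + j.natAbs → b (i, j) = 0) ∧
      Agree r b q := by
  let φ : ℤ → ℤ → ℤ := fun i j => max 0 ((D + 4 * r : ℕ) - i.natAbs - j.natAbs)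
  have hφ : ∀ i j i' j', φ i j ≤ φ i' j' + (i - i').natAbs + (j - j').natAbs := by
    intro i j i' j'
    simp only [φ]
    omega
  refine ⟨fun u => max (min (q u) (φ u.1 u.2)) (-φ u.1 u.2), ?_, fun i j h => ?_,
    fun i j hi hj => ?_⟩
  · intro i j i' j'
    have := hq i j i' j'
    have := hφ i j i' j'
    have := hφ i' j' i j
    dsimp only
    omega
  · dsimp only [φ]
    omega
  · have := hq i j 0 0
    have := hq 0 0 i j
    dsimp only [φ]
    omega

/-- The closed `ℓ¹` balls of radius `K` are disjoint, so the pieces do not conflict. Lipschitz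
continuity need only be tested on neighbours: if one lies strictly inside a ball, both lie in the
closed ball; otherwise both values vanish. -/
theorem exists_glue {ι : Type*} {K : ℕ} {c : ι → ℤ × ℤ} {b : ι → Config ℤ}
    (hb : ∀ k, Lip (b k)) (hb0 : ∀ k, ∀ i j : ℤ, K ≤ i.natAbs + j.natAbs → b k (i, j) = 0)
    (hsep : ∀ k l, k ≠ l →
      2 * K + 1 ≤ ((c k).1 - (c l).1).natAbs + ((c k).2 - (c l).2).natAbs) :
    ∃ q, Lip q ∧ (∀ k, ∀ i j : ℤ, (i - (c k).1).natAbs + (j - (c k).2).natAbs ≤ K →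
        q (i, j) = b k (i - (c k).1, j - (c k).2)) ∧
      ∀ i j : ℤ, (∀ k, K < (i - (c k).1).natAbs + (j - (c k).2).natAbs) → q (i, j) = 0 := by
  classical
  let near : ℤ × ℤ → ι → Prop := fun u k => (u.1 - (c k).1).natAbs + (u.2 - (c k).2).natAbs ≤ K
  let q : Config ℤ := fun u =>
    if h : ∃ k, near u k then b h.choose (u.1 - (c h.choose).1, u.2 - (c h.choose).2) else 0
  have huniq : ∀ u k l, near u k → near u l → k = l := by
    intro u k l hk hl
    by_contra hkl
    have := hsep k l hkl
    simp only [near] at hk hl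
    omega
  have hin : ∀ k, ∀ i j : ℤ, (i - (c k).1).natAbs + (j - (c k).2).natAbs ≤ K →
      q (i, j) = b k (i - (c k).1, j - (c k).2) := by
    intro k i j h
    have h' : ∃ k, near (i, j) k := ⟨k, h⟩
    have : h'.choose = k := huniq _ _ _ h'.choose_spec h
    simp only [q, dif_pos h', this]
  have hout : ∀ i j : ℤ, (∀ k, K ≤ (i - (c k).1).natAbs + (j - (c k).2).natAbs) →
      q (i, j) = 0 := by
    intro i j h
    by_cases h' : ∃ k, near (i, j) k
    · obtain ⟨k, hk⟩ := h'
      rw [hin k i j hk, hb0 k _ _ (h k)]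
    · simp only [q, dif_neg h']
  have hstep : ∀ i j i' j' : ℤ, (i - i').natAbs + (j - j').natAbs ≤ 1 →
      (∃ k, (i - (c k).1).natAbs + (j - (c k).2).natAbs < K) →
      (q (i, j) - q (i', j')).natAbs ≤ 1 := by
    rintro i j i' j' h ⟨k, hk⟩
    rw [hin k i j hk.le, hin k i' j' (by omega)]
    have := hb k (i - (c k).1) (j - (c k).2) (i' - (c k).1) (j' - (c k).2)
    have := hb k (i' - (c k).1) (j' - (c k).2) (i - (c k).1) (j - (c k).2)
    omega
  have hstep' : ∀ i j i' j' : ℤ, (i - i').natAbs + (j - j').natAbs ≤ 1 →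
      (q (i, j) - q (i', j')).natAbs ≤ 1 := by
    intro i j i' j' h
    by_cases h1 : ∃ k, (i - (c k).1).natAbs + (j - (c k).2).natAbs < K
    · exact hstep i j i' j' h h1
    by_cases h2 : ∃ k, (i' - (c k).1).natAbs + (j' - (c k).2).natAbs < K
    · rw [← Int.natAbs_neg, neg_sub]
      exact hstep i' j' i j (by omega) h2
    · push Not at h1 h2
      rw [hout i j h1, hout i' j' h2]
      simp
  exact ⟨q, lip_of_step (fun i j => hstep' _ _ _ _ (by omega))
    (fun i j => hstep' _ _ _ _ (by omega)), hin, fun i j h => hout i j fun k => (h k).le⟩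

theorem Lip.exists_periodic {q : Config ℤ} (hq : Lip q) (r : ℕ) :
    ∃ q', Lip q' ∧ Agree r q' q ∧ ∃ N : ℕ, 0 < N ∧ ∀ a b : ℤ, shift (N * a, N * b) q' = q' := by
  obtain ⟨b, hb, hb0, hag⟩ := hq.exists_cutoff le_rfl r
  set K : ℕ := (q (0, 0)).natAbs + 4 * r
  let N : ℕ := 2 * K + 1
  have hsep : ∀ a a' : ℤ, a ≠ a' → N ≤ (N * a - N * a').natAbs := by
    intro a a' h
    rw [← mul_sub, Int.natAbs_mul, Int.natAbs_natCast]
    exact Nat.le_mul_of_pos_right N (by omega)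
  obtain ⟨q', hq', hin, hout⟩ := exists_glue (K := K)
    (c := fun k : ℤ × ℤ => ((N : ℤ) * k.1, (N : ℤ) * k.2)) (b := fun _ => b) (fun _ => hb)
    (fun _ => hb0) (by
      intro k l hkl
      rcases eq_or_ne k.1 l.1 with h | h
      · have := hsep _ _ fun h' => hkl (Prod.ext h h')
        dsimp only
        omega
      · have := hsep _ _ h
        dsimp only
        omega)
  refine ⟨q', hq', fun i j hi hj => ?_, N, by omega, fun a a' => ?_⟩
  · rw [hin (0, 0) i j (by simp; omega)]
    simpa using hag i j hi hj
  · funext ⟨i, j⟩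
    rw [shift_mk]
    by_cases h : ∃ k : ℤ × ℤ, (i - N * k.1).natAbs + (j - N * k.2).natAbs ≤ K
    · obtain ⟨k, hk⟩ := h
      have e1 : i - N * a - N * (k.1 - a) = i - N * k.1 := by ring
      have e2 : j - N * a' - N * (k.2 - a') = j - N * k.2 := by ring
      rw [hin k i j hk, hin (k.1 - a, k.2 - a') _ _ (by simpa only [e1, e2] using hk)]
      simp only [e1, e2]
    · push Not at h
      rw [hout i j h, hout]
      intro k
      have := h (k.1 + a, k.2 + a')
      simp only [mul_add, ← sub_sub] at this
      rwa [sub_right_comm i, sub_right_comm j]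

end Glue

/-! ### Fully supported measures -/

section Measure

variable {A B : Type*} [TopologicalSpace B]

/-- Averaging over the finite group `(ℤ/M)²` works, since a translation merely permutes the cosets.
The coset of 0 contributes a positive multiple of `μ`, so sets charged by `μ` remain charged. -/
theorem exists_invariant_measure [MeasurableSpace (Config B)] [BorelSpace (Config B)]
    (μ : Measure (Config B)) [IsProbabilityMeasure μ] (M : ℕ) [NeZero M]
    (hμ : ∀ a b : ℤ, μ.map (shift (M * a, M * b)) = μ) :
    ∃ ν : Measure (Config B), IsProbabilityMeasure ν ∧
      (∀ g, MeasurePreserving (shift g) ν ν) ∧ (∀ s, μ s ≠ 0 → ν s ≠ 0) ∧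
      ∀ X, MeasurableSet X → ShiftInvariant X → μ Xᶜ = 0 → ν Xᶜ = 0 := by
  have hm : ∀ g, Measurable (shift g : Config B → Config B) :=
    fun g => (continuous_shift g).measurable
  let m : ZMod M × ZMod M → Measure (Config B) := fun k =>
    μ.map (shift ((k.1.val : ℤ), (k.2.val : ℤ)))
  have hp : ∀ k, IsProbabilityMeasure (m k) := fun k =>
    Measure.isProbabilityMeasure_map (hm _).aemeasurable
  have hmod : ∀ (g : ℤ × ℤ) (k : ZMod M × ZMod M), (g.1 : ZMod M) = k.1 →
      (g.2 : ZMod M) = k.2 → μ.map (shift g) = m k := by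
    intro g k h1 h2
    have h1' : ((g.1 : ℤ) : ZMod M) = ((k.1.val : ℤ) : ZMod M) := by simp [h1]
    have h2' : ((g.2 : ℤ) : ZMod M) = ((k.2.val : ℤ) : ZMod M) := by simp [h2]
    rw [ZMod.intCast_eq_intCast_iff_dvd_sub] at h1' h2'
    obtain ⟨a, ha⟩ := h1'
    obtain ⟨b, hb⟩ := h2'
    calc μ.map (shift g) = (μ.map (shift (M * a, M * b))).map (shift g) := by rw [hμ]
      _ = m k := by
        rw [Measure.map_map (hm _) (hm _)]
        congr 1
        funext x
        rw [Function.comp_apply, shift_shift]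
        congr 1
        ext
        · simp [← ha]
        · simp [← hb]
  have hpos : ((M : ENNReal) * M) ≠ 0 := by simp [NeZero.ne M]
  have hfin : ((M : ENNReal) * M) ≠ ⊤ := by finiteness
  refine ⟨((M : ENNReal) * M)⁻¹ • ∑ k, m k, ⟨?_⟩, fun g => ⟨hm g, ?_⟩, fun s hs => ?_,
    fun X hX hinv h0 => ?_⟩
  · simp only [Measure.smul_apply, Measure.finsetSum_apply, measure_univ, smul_eq_mul,
      Finset.sum_const, Finset.card_univ, Fintype.card_prod, ZMod.card, nsmul_eq_mul, mul_one,
      Nat.cast_mul]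
    exact ENNReal.inv_mul_cancel hpos hfin
  · rw [Measure.map_smul, Measure.map_finset_sum (hm g).aemeasurable]
    congr 1
    refine Fintype.sum_equiv (Equiv.addLeft ((g.1 : ZMod M), (g.2 : ZMod M))) _ _ fun k => ?_
    rw [Measure.map_map (hm _) (hm _)]
    have : (shift g ∘ shift ((k.1.val : ℤ), (k.2.val : ℤ)) : Config B → Config B) =
        shift (g + ((k.1.val : ℤ), (k.2.val : ℤ))) := by
      funext x
      exact shift_shift _ _ _
    rw [this]
    exact hmod _ _ (by simp) (by simp)
  · have h0 : m 0 = μ := by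
      simp only [m, Prod.fst_zero, Prod.snd_zero, ZMod.val_zero, Nat.cast_zero]
      have : (shift (0, 0) : Config B → Config B) = id := funext shift_zero
      rw [this, Measure.map_id]
    rw [Measure.smul_apply, Measure.finsetSum_apply, smul_eq_mul]
    refine mul_ne_zero (ENNReal.inv_ne_zero.2 hfin) fun h => hs ?_
    rw [← h0]
    exact (Finset.sum_eq_zero_iff.1 h) 0 (Finset.mem_univ _)
  · rw [Measure.smul_apply, Measure.finsetSum_apply, Finset.sum_eq_zero, smul_zero]
    intro k _
    rw [Measure.map_apply (hm _) hX.compl]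
    exact measure_mono_null (fun x hx hx' => hx (hinv _ x hx')) h0

variable [DiscreteTopology B]

/-- A convex combination of countably many measures, one for each point of a dense sequence and each
radius, charges every window of `X`. -/
theorem hasFullySupportedMeasure_of_forall_window [Finite B] {X : Set (Config B)}
    (hX : IsClosed X) (hne : X.Nonempty)
    (h : ∀ y ∈ X, ∀ R, letI : MeasurableSpace (Config B) := borel (Config B)
      ∃ ν : Measure (Config B), IsProbabilityMeasure ν ∧
        (∀ g, MeasurePreserving (shift g) ν ν) ∧ ν {z | Agree R z y} ≠ 0 ∧ ν Xᶜ = 0) :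
    HasFullySupportedMeasure X := by
  let _ : MeasurableSpace (Config B) := borel (Config B)
  have : BorelSpace (Config B) := ⟨rfl⟩
  have : Nonempty X := hne.to_subtype
  obtain ⟨d, hd⟩ := TopologicalSpace.exists_dense_seq X
  choose ν hp hinv hpos hnull using fun (n R : ℕ) => h (d n) (d n).2 R
  let w : ℕ → ENNReal := fun n => 2⁻¹ ^ (n + 1)
  have hw : ∀ n, w n ≠ 0 := fun n => pow_ne_zero _ (by simp)
  let μ : Measure (Config B) := Measure.sum fun n => w n • ν n.unpair.1 n.unpair.2
  have hμnull : μ Xᶜ = 0 := by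
    rw [Measure.sum_apply _ hX.measurableSet.compl]
    simp [hnull]
  refine ⟨μ, ⟨?_⟩, fun g => ⟨(continuous_shift g).measurable, ?_⟩, ?_⟩
  · rw [Measure.sum_apply _ MeasurableSet.univ]
    simp only [Measure.smul_apply, measure_univ, smul_eq_mul, mul_one, w]
    rw [ENNReal.tsum_geometric_add_one, ENNReal.one_sub_inv_two]
    exact ENNReal.mul_inv_cancel (by simp) (by simp)
  · rw [Measure.map_sum (continuous_shift g).measurable.aemeasurable]
    congr 1
    funext n
    rw [Measure.map_smul, (hinv _ _ g).map_eq]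
  · refine Subset.antisymm (Measure.support_subset_of_isClosed hX (by simpa [mem_ae_iff]))
      fun y hy => (Measure.mem_support_iff_forall y).2 fun U hU => ?_
    obtain ⟨R, -, hR⟩ := (nhds_hasBasis_agree y).mem_iff.1 hU
    obtain ⟨n, hn⟩ := hd.exists_mem_open
      ((isClopen_agree R y).isOpen.preimage continuous_subtype_val) ⟨⟨y, hy⟩, Agree.refl R y⟩
    refine pos_iff_ne_zero.2 fun h0 => ?_
    have h1 : μ {z | Agree R z y} = 0 := measure_mono_null hR h0
    rw [Measure.sum_apply _ (isClopen_agree R y).1.measurableSet, ENNReal.tsum_eq_zero] at h1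
    have h2 := h1 (Nat.pair n R)
    simp only [Nat.unpair_pair, Measure.smul_apply, smul_eq_mul, mul_eq_zero, hw, false_or] at h2
    refine hpos n R (measure_mono_null (fun z hz => ?_) h2)
    exact Agree.trans hz hn

variable [TopologicalSpace A] [DiscreteTopology A] {e : Option A ≃ B}

theorem measure_fabric [Finite A] [Finite B] (W : Set (Config A)) (hW : IsSubshift W)
    (hm : HasFullySupportedMeasure W) : HasFullySupportedMeasure (setImage (fabric e) W) := by
  let _ : MeasurableSpace (Config A) := borel (Config A)
  have : BorelSpace (Config A) := ⟨rfl⟩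
  let _ : MeasurableSpace (Config B) := borel (Config B)
  have : BorelSpace (Config B) := ⟨rfl⟩
  obtain ⟨μ, hμ, hinv, hsupp⟩ := hm
  have hX : IsSubshift (setImage (fabric e) W) := isSubshift_fabric W hW
  have hnull : μ Wᶜ = 0 := hsupp ▸ Measure.measure_compl_support
  refine hasFullySupportedMeasure_of_forall_window hX.1 ?_ fun y hy R => ?_
  · obtain ⟨x, hx⟩ : W.Nonempty := hsupp ▸ Measure.nonempty_support (NeZero.ne μ)
    obtain ⟨y, hy⟩ := fabric_nonempty (e := e) x
    exact ⟨y, mem_setImage.2 ⟨x, hx, hy⟩⟩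
  obtain ⟨x, hx, q, hq, rfl⟩ := (mem_setImage_fabric hW.2).1 hy
  obtain ⟨q', hq', hag, N, hN, hper⟩ := hq.exists_periodic ((q (0, 0)).natAbs + 2 * R)
  have hΦ : Measurable (weave e q') := (continuous_weave e hq').measurable
  have hs : ∀ g, Measurable (shift g : Config B → Config B) :=
    fun g => (continuous_shift g).measurable
  have : IsProbabilityMeasure (μ.map (weave e q')) :=
    Measure.isProbabilityMeasure_map hΦ.aemeasurable
  have : NeZero (4 * N) := ⟨by omega⟩
  obtain ⟨ν, hν, hνinv, hνpos, hνnull⟩ := exists_invariant_measure (μ.map (weave e q')) (4 * N) (by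
    intro a b
    rw [Measure.map_map (hs _) hΦ]
    -- The displacement `q'` is unchanged by the lattice `N ℤ²`. The weave stretches one coordinate
    -- by 4, so `4 N` serves for both.
    have : (shift ((4 * N : ℕ) * a, (4 * N : ℕ) * b) : Config B → Config B) ∘ weave e q' =
        weave e q' ∘ shift (N * b, N * (4 * a)) := by
      funext z
      have := shift_weave (e := e) (x := z) hq' (N * b) (N * (4 * a)) 0
      simp only [add_zero, hper] at this
      rw [Function.comp_apply, Function.comp_apply, ← this]
      congr 1
      ext <;> push_cast <;> ring
    rw [this, ← Measure.map_map hΦ (continuous_shift _).measurable, (hinv _).map_eq])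
  refine ⟨ν, hν, hνinv, hνpos _ ?_, hνnull _ hX.1.measurableSet hX.2 ?_⟩
  · rw [Measure.map_apply hΦ (isClopen_agree _ _).1.measurableSet]
    have hx' : x ∈ μ.support := hsupp ▸ hx
    have := (Measure.mem_support_iff_forall x).1 hx' _
      ((nhds_hasBasis_agree x).mem_of_mem (i := (q (0, 0)).natAbs + 2 * R) trivial)
    refine (this.trans_le (measure_mono fun z hz => ?_)).ne'
    exact (agree_weave hq hq' le_rfl hag.symm (Agree.symm hz)).symm
  · rw [Measure.map_apply hΦ hX.1.measurableSet.compl]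
    refine measure_mono_null (t := Wᶜ) (fun z hz hzW => hz ?_) hnull
    exact (mem_setImage_fabric hW.2).2 ⟨z, hzW, q', hq', rfl⟩

theorem isOrbitCoding_fabric [Finite A] [Finite B] (e : Option A ≃ B) :
    IsOrbitCoding (fabric e) where
  congr _ _ := fabric_congr
  nonempty := fabric_nonempty
  orbit_subset := orbit_subset_fabric
  orbit_eq := orbit_eq_of_mem_fabric
  isSubshift := isSubshift_fabric
  isSFT := isSFT_fabric
  measure := measure_fabric
  closure_iff := closure_iff_fabric
  reflects := reflects_fabric

end Measure

/-! ### Covers by complements of two sets -/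

section Entropy

variable {A : Type*}

theorem finite_box (n : ℕ) : (box n).Finite := (finite_Ico _ _).prod (finite_Ico _ _)

theorem finite_refinement {𝒰 : Set (Set (Config A))} (h𝒰 : 𝒰.Finite) (n : ℕ) :
    (refinement 𝒰 n).Finite := by
  have := h𝒰.to_subtype
  have := (finite_box n).to_subtype
  refine (Set.finite_range fun c : box n → 𝒰 => ⋂ g : box n, shift g.1 ⁻¹' (c g).1).subset ?_
  rintro _ ⟨c, hc, rfl⟩
  exact ⟨fun g => ⟨c g, hc g g.2⟩, iInter_subtype _ _⟩

theorem coverNumber_le {X : Set (Config A)} {𝒱 : Set (Set (Config A))}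
    {F : Finset (Set (Config A))} (hF : (F : Set (Set (Config A))) ⊆ 𝒱)
    (hX : X ⊆ ⋃₀ (F : Set (Set (Config A)))) : coverNumber X 𝒱 ≤ F.card :=
  Nat.sInf_le ⟨F, hF, hX, rfl⟩

theorem exists_card_eq_coverNumber {X : Set (Config A)} {𝒱 : Set (Set (Config A))}
    (h𝒱 : 𝒱.Finite) (hX : X ⊆ ⋃₀ 𝒱) : ∃ F : Finset (Set (Config A)),
      (F : Set (Set (Config A))) ⊆ 𝒱 ∧ X ⊆ ⋃₀ (F : Set (Set (Config A))) ∧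
        F.card = coverNumber X 𝒱 :=
  Nat.sInf_mem (s := {k | ∃ F : Finset (Set (Config A)), (F : Set (Set (Config A))) ⊆ 𝒱 ∧
    X ⊆ ⋃₀ (F : Set (Set (Config A))) ∧ F.card = k})
    ⟨_, h𝒱.toFinset, by simp, by simpa using hX, rfl⟩

variable {X K L : Set (Config A)}

/-- If no orbit of `X` visits both `K` and `L`, their complements form a cover without entropy. -/
theorem coverEntropy_le_zero (hX : ShiftInvariant X)
    (h : ∀ z ∈ X, ∀ k k', shift k z ∈ K → shift k' z ∉ L) :
    coverEntropy X {X \ K, X \ L} ≤ 0 := by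
  classical
  have hN : ∀ n, coverNumber X (refinement {X \ K, X \ L} n) ≤ 2 := by
    intro n
    refine (coverNumber_le (F := {⋂ g ∈ box n, shift g ⁻¹' (X \ K),
      ⋂ g ∈ box n, shift g ⁻¹' (X \ L)}) ?_ fun z hz => ?_).trans Finset.card_le_two
    · intro V hV
      simp only [Finset.coe_insert, Finset.coe_singleton, mem_insert_iff, mem_singleton_iff] at hV
      rcases hV with rfl | rfl
      · exact ⟨fun _ => X \ K, fun _ _ => Or.inl rfl, rfl⟩
      · exact ⟨fun _ => X \ L, fun _ _ => Or.inr rfl, rfl⟩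
    · by_cases hk : ∃ k, shift k z ∈ K
      · obtain ⟨k, hk⟩ := hk
        exact mem_sUnion.2 ⟨⋂ g ∈ box n, shift g ⁻¹' (X \ L), by simp,
          mem_iInter₂.2 fun g _ => ⟨hX g z hz, h z hz k g hk⟩⟩
      · exact mem_sUnion.2 ⟨⋂ g ∈ box n, shift g ⁻¹' (X \ K), by simp,
          mem_iInter₂.2 fun g _ => ⟨hX g z hz, fun hg => hk ⟨g, hg⟩⟩⟩
  have hlim : Tendsto (fun n : ℕ => ((Real.log 2 / (n : ℝ) ^ 2 : ℝ) : EReal)) atTop (𝓝 0) := by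
    have h1 : Tendsto (fun n : ℕ => (n : ℝ) ^ 2) atTop atTop :=
      (tendsto_pow_atTop two_ne_zero).comp tendsto_natCast_atTop_atTop
    exact (continuous_coe_real_ereal.tendsto 0).comp (tendsto_const_nhds.div_atTop h1)
  rw [← hlim.limsup_eq]
  refine limsup_le_limsup (Eventually.of_forall fun n => EReal.coe_le_coe_iff.2 ?_)
  refine div_le_div_of_nonneg_right ?_ (by positivity)
  -- The cover number may be 0, where the logarithm is 0 by convention.
  rcases Nat.eq_zero_or_pos (coverNumber X (refinement {X \ K, X \ L} n)) with h0 | h0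
  · rw [h0, Nat.cast_zero, Real.log_zero]
    exact Real.log_nonneg (by norm_num)
  · exact Real.log_le_log (by exact_mod_cast h0) (by exact_mod_cast hN n)

/-- If `K` and `L` can be visited independently along `P`, every refined cover needs at least
`2 ^ #P` elements. -/
theorem two_pow_card_le_coverNumber (hX : ShiftInvariant X) (hKL : Disjoint K L) {n : ℕ}
    {P : Finset (ℤ × ℤ)} (hP : (P : Set (ℤ × ℤ)) ⊆ box n)
    (h : ∀ Q ⊆ P, ∃ z ∈ X, ∀ g ∈ P, (g ∈ Q → shift g z ∈ K) ∧ (g ∉ Q → shift g z ∈ L)) :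
    2 ^ P.card ≤ coverNumber X (refinement {X \ K, X \ L} n) := by
  classical
  -- An infimum over the empty set would be 0, so the lower bound needs some finite subfamily that
  -- covers `X`; disjointness of `K` and `L` provides it.
  obtain ⟨F, hF, hXF, hcard⟩ := exists_card_eq_coverNumber (X := X)
    (finite_refinement (𝒰 := {X \ K, X \ L}) (by simp) n) (by
      intro z hz
      refine ⟨_, ⟨fun g => if shift g z ∈ K then X \ L else X \ K, fun g _ => ?_, rfl⟩,
        mem_iInter₂.2 fun g _ => ?_⟩
      · dsimp only
        split_ifs <;> simp
      · rw [mem_preimage]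
        dsimp only
        split_ifs with hg
        · exact ⟨hX g z hz, hKL.notMem_of_mem_left hg⟩
        · exact ⟨hX g z hz, hg⟩)
  have h' : ∀ Q ∈ P.powerset, ∃ V ∈ F, ∃ z ∈ V, ∀ g ∈ P,
      (g ∈ Q → shift g z ∈ K) ∧ (g ∉ Q → shift g z ∈ L) := by
    intro Q hQ
    obtain ⟨z, hz, hzQ⟩ := h Q (Finset.mem_powerset.1 hQ)
    obtain ⟨V, hV, hzV⟩ := hXF hz
    exact ⟨V, hV, z, hzV, hzQ⟩
  choose! V hVF z hzV hz using h'
  rw [← hcard, ← Finset.card_powerset]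
  refine Finset.card_le_card_of_injOn V hVF ?_
  -- At a site of `Q` outside `Q'` one point is in `K` and the other in `L`, but a single member of
  -- the refined cover excludes `K` or `L` at that site.
  have hsub : ∀ Q ∈ P.powerset, ∀ Q' ∈ P.powerset, V Q = V Q' → Q ⊆ Q' := by
    intro Q hQ Q' hQ' hV g hg
    by_contra hg'
    have hgP := Finset.mem_powerset.1 hQ hg
    obtain ⟨c, hc, hVc⟩ := hF (hVF Q hQ)
    have h1 : shift g (z Q hQ) ∈ c g := mem_iInter₂.1 (hVc ▸ hzV Q hQ) g (hP hgP)
    have h2 : shift g (z Q' hQ') ∈ c g := mem_iInter₂.1 (hVc ▸ hV ▸ hzV Q' hQ') g (hP hgP)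
    rcases hc g (hP hgP) with h3 | h3
    · exact (h3 ▸ h1).2 ((hz Q hQ g hgP).1 hg)
    · exact (h3 ▸ h2).2 ((hz Q' hQ' g hgP).2 hg')
  exact fun Q hQ Q' hQ' hV => (hsub Q hQ Q' hQ' hV).antisymm (hsub Q' hQ' Q hQ hV.symm)

theorem coverEntropy_pos (hX : ShiftInvariant X) (hKL : Disjoint K L) {δ : ℝ} (hδ : 0 < δ)
    {C : ℕ} (hC : 0 < C)
    (h : ∀ m : ℕ, ∃ P : Finset (ℤ × ℤ), (P : Set (ℤ × ℤ)) ⊆ box (C * m) ∧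
      δ * (m : ℝ) ^ 2 ≤ P.card ∧
      ∀ Q ⊆ P, ∃ z ∈ X, ∀ g ∈ P, (g ∈ Q → shift g z ∈ K) ∧ (g ∉ Q → shift g z ∈ L)) :
    0 < coverEntropy X {X \ K, X \ L} := by
  have hlog : 0 < Real.log 2 := Real.log_pos (by norm_num)
  have hpos : (0 : EReal) < ((δ * Real.log 2 / (C : ℝ) ^ 2 : ℝ) : EReal) :=
    EReal.coe_pos.2 (by positivity)
  refine hpos.trans_le (le_limsup_of_frequently_le (frequently_atTop.2 fun a => ?_))
  obtain ⟨P, hP, hcard, hind⟩ := h (a + 1)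
  refine ⟨C * (a + 1), by nlinarith, EReal.coe_le_coe_iff.2 ?_⟩
  have h1 := two_pow_card_le_coverNumber hX hKL hP hind
  have h2 : (P.card : ℝ) * Real.log 2 ≤
      Real.log (coverNumber X (refinement {X \ K, X \ L} (C * (a + 1)))) := by
    rw [← Real.log_pow]
    exact Real.log_le_log (by positivity) (by exact_mod_cast h1)
  have h3 : δ * ((a + 1 : ℕ) : ℝ) ^ 2 * Real.log 2 ≤ P.card * Real.log 2 := by gcongr
  rw [div_le_div_iff₀ (by positivity) (by positivity)]
  calc δ * Real.log 2 * ((C * (a + 1) : ℕ) : ℝ) ^ 2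
      = δ * ((a + 1 : ℕ) : ℝ) ^ 2 * Real.log 2 * (C : ℝ) ^ 2 := by push_cast; ring
    _ ≤ _ := by
      gcongr
      exact h3.trans h2

variable [TopologicalSpace A]

/-- Along a lattice, some point of `W` visits `U` with at least the expected frequency. -/
theorem exists_card_visits_ge [MeasurableSpace (Config A)] [BorelSpace (Config A)]
    {μ : Measure (Config A)} [IsProbabilityMeasure μ]
    (hμ : ∀ g, MeasurePreserving (shift g) μ μ) {W U : Set (Config A)} (hW : μ Wᶜ = 0)
    (hU : MeasurableSet U) (C m : ℕ) :
    ∃ z ∈ W, ∃ G : Finset (ℤ × ℤ), (G : Set (ℤ × ℤ)) ⊆ box m ∧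
      (μ U).toReal * (m : ℝ) ^ 2 ≤ G.card ∧ ∀ k ∈ G, shift (C * k.1, C * k.2) z ∈ U := by
  classical
  let S : Finset (ℤ × ℤ) := Finset.Ico (0 : ℤ) m ×ˢ Finset.Ico (0 : ℤ) m
  have hpre : ∀ g, MeasurableSet (shift g ⁻¹' U) := fun g => (hμ g).measurable hU
  have hint : ∫⁻ z, ∑ k ∈ S, (shift (C * k.1, C * k.2) ⁻¹' U).indicator 1 z ∂μ =
      (m * m : ℕ) * μ U := by
    rw [lintegral_finsetSum _ fun k _ => measurable_one.indicator (hpre _)]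
    simp only [lintegral_indicator_one (hpre _), (hμ _).measure_preimage hU.nullMeasurableSet]
    simp [S]
  obtain ⟨z, hz, hle⟩ := exists_notMem_null_lintegral_le (μ := μ)
    (f := fun z => ∑ k ∈ S, (shift (C * k.1, C * k.2) ⁻¹' U).indicator 1 z)
    (by rw [hint]; finiteness) hW
  refine ⟨z, notMem_compl_iff.1 hz, S.filter fun k => shift (C * k.1, C * k.2) z ∈ U,
    fun k hk => ?_, ?_, fun k hk => (Finset.mem_filter.1 hk).2⟩
  · have := (Finset.mem_filter.1 hk).1
    simp only [S, Finset.mem_product, Finset.mem_Ico] at this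
    exact this
  · rw [hint] at hle
    have : ∑ k ∈ S, (shift (C * k.1, C * k.2) ⁻¹' U).indicator (1 : Config A → ENNReal) z =
        ((S.filter fun k => shift (C * k.1, C * k.2) z ∈ U).card : ENNReal) := by
      simp [indicator_apply]
    rw [this] at hle
    have := ENNReal.toReal_mono (by finiteness) hle
    rw [ENNReal.toReal_mul, ENNReal.toReal_natCast, ENNReal.toReal_natCast] at this
    calc (μ U).toReal * (m : ℝ) ^ 2 = (m * m : ℕ) * (μ U).toReal := by push_cast; ring
      _ ≤ _ := this

variable [DiscreteTopology A]

/-- Were two patterns never to appear together, the cylinders they define would be disjoint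
neighbourhoods visited by no common orbit, and the associated cover would have no entropy. -/
theorem IsEntropyPair.isTransitivityPair (hX : IsSubshift X) {y y' : Config A}
    (h : IsEntropyPair X y y') : IsTransitivityPair X y y' := by
  obtain ⟨hy, hy', -, h⟩ := h
  refine isTransitivityPair_of_agree hy hy' fun r g g' => ?_
  by_contra! hcon
  have hcl : ∀ (g : ℤ × ℤ) (w : Config A), IsClopen {z | Agree r (shift g z) w} := fun g w =>
    (isClopen_agree r w).preimage (continuous_shift g)
  have hnhds : ∀ (g : ℤ × ℤ) (w : Config A),
      X ∩ {z | Agree r (shift g z) (shift g w)} ∈ 𝓝[X] w := fun g w =>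
    inter_mem_nhdsWithin _ ((hcl g _).isOpen.mem_nhds (Agree.refl r _))
  refine (coverEntropy_le_zero hX.2 ?_).not_gt (h (X ∩ {z | Agree r (shift g z) (shift g y)})
    (X ∩ {z | Agree r (shift g' z) (shift g' y')}) inter_subset_left inter_subset_left
    (hX.1.inter (hcl _ _).isClosed) (hX.1.inter (hcl _ _).isClosed) (hnhds _ _) (hnhds _ _) ?_)
  · rintro z hz k k' ⟨-, hk⟩ ⟨-, hk'⟩
    exact hcon z hz (g + k) (g' + k') (by simpa using hk) (by simpa using hk')
  · exact disjoint_left.2 fun z hz hz' => hcon z hz.1 g g' hz.2 hz'.2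

theorem IsEntropyOrEqualPair.isTransitivityPair (hX : IsSubshift X) {y y' : Config A}
    (h : IsEntropyOrEqualPair X y y') : IsTransitivityPair X y y' := by
  obtain ⟨hy, hy', rfl | h⟩ := h
  · exact ⟨hy, hy', fun v v' hv hv' => ⟨y, hy, hv, hv'⟩⟩
  · exact h.isTransitivityPair hX

end Entropy

/-! ### Independence in a double fabric -/

section Independence

variable {A B C : Type*}

/-- Near `a k` the displacement is `q k` plus the constant `t k - 4 (a k).1`, which carries the
window found there to height `t k`. Cutting off at radius `D + E + 4 (D + 2 R)` lets these local
choices be made independently. -/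
theorem exists_glued_weave (e : Option A ≃ B) {ι : Type*} {D E R : ℕ} (z : Config A)
    {a : ι → ℤ × ℤ} {t : ι → ℤ} {q : ι → Config ℤ} {x : ι → Config A} (hq : ∀ k, Lip (q k))
    (h0 : ∀ k, (q k (0, 0)).natAbs ≤ D) (ht : ∀ k, (t k - 4 * (a k).1).natAbs ≤ E)
    (hx : ∀ k, Agree (D + 2 * R) (shift (-a k) z) (x k))
    (hsep : ∀ k l, k ≠ l → 2 * (D + E + 4 * (D + 2 * R)) + 1 ≤
      ((a k).1 - (a l).1).natAbs + ((a k).2 - (a l).2).natAbs) :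
    ∃ p, Lip p ∧ ∀ k,
      Agree R (shift (-((a k).2, t k)) (weave e p z)) (weave e (q k) (x k)) := by
  have hcut := fun k => ((hq k).shift_add 0 (t k - 4 * (a k).1)).exists_cutoff (D := D + E) (by
    have := h0 k
    have := ht k
    simp only [shift_zero]
    omega) (D + 2 * R)
  choose b hb hb0 hag using hcut
  obtain ⟨p, hp, hin, -⟩ := exists_glue hb hb0 hsep
  refine ⟨p, hp, fun k => ?_⟩
  have hs := shift_weave (e := e) (x := z) hp (-(a k).1) (-(a k).2) (4 * (a k).1 - t k)
  rw [show -((a k).2, t k) = (-(a k).2, 4 * -(a k).1 + (4 * (a k).1 - t k)) from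
    Prod.ext rfl (by dsimp only [Prod.snd_neg]; ring), hs]
  refine (agree_weave (hq k) (hp.shift_add _ _) (h0 k) (fun i j hi hj => ?_) (hx k).symm).symm
  have h1 := hin k (i + (a k).1) (j + (a k).2) (by
    rw [add_sub_cancel_right, add_sub_cancel_right]
    omega)
  have h2 := hag k i j hi hj
  rw [add_sub_cancel_right, add_sub_cancel_right, h2, shift_zero] at h1
  simp only [shift_mk, sub_neg_eq_add, h1]
  ring

/-- Over a point `z` that shows both of two given windows near each point of a sparse set, a
double weave can be chosen to show, near each point of a lattice image of that set, any prescribed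
one of two double weaves. -/
theorem exists_double_weave (e : Option A ≃ B) (e' : Option B ≃ C) {D E R N : ℕ} (z : Config A)
    {q p : Bool → Config ℤ} {x : Bool → Config A} {s : Bool → ℤ × ℤ}
    (hq : ∀ c, Lip (q c)) (hp : ∀ c, Lip (p c)) (hq0 : ∀ c, (q c (0, 0)).natAbs ≤ D)
    (hp0 : ∀ c, (p c (0, 0)).natAbs ≤ D) (hs : ∀ c, 4 * (s c).1.natAbs ≤ E)
    (hs' : ∀ c, 4 * (s c).2.natAbs ≤ E)
    (hN : 2 * (D + E + 4 * (D + 2 * (D + 2 * R))) + 1 + E ≤ N) {G : Set (ℤ × ℤ)}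
    (hz : ∀ k ∈ G, ∀ c,
      Agree (D + 2 * (D + 2 * R)) (shift (s c) (shift (N * k.1, N * k.2) z)) (x c))
    (β : ℤ × ℤ → Bool) :
    ∃ q' p', Lip q' ∧ Lip p' ∧ ∀ k ∈ G,
      Agree R (shift (4 * N * k.1, 4 * N * k.2) (weave e' p' (weave e q' z)))
        (weave e' (p (β k)) (weave e (q (β k)) (x (β k)))) := by
  have hsep : ∀ i j : ℤ, i ≠ j → N ≤ (N * i - N * j).natAbs := by
    intro i j h
    rw [← mul_sub, Int.natAbs_mul, Int.natAbs_natCast]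
    exact Nat.le_mul_of_pos_right N (by omega)
  -- Signs are reversed because `shift g` brings the position `-g` to the origin. This weave cancels
  -- the first coordinate of the offset `s (β k)`; the next one, acting on exchanged coordinates,
  -- cancels the second. The final place thus does not depend on `β k`.
  obtain ⟨q', hq', h1⟩ := exists_glued_weave (ι := G) e (D := D) (E := E) (R := D + 2 * R) z
    (a := fun k => -(s (β k) + (N * k.1.1, N * k.1.2))) (t := fun k => -(4 * (N * k.1.1)))
    (q := fun k => q (β k)) (x := fun k => x (β k)) (fun _ => hq _) (fun _ => hq0 _)
    (fun k => by
      have := hs (β k)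
      simp only [Prod.fst_neg, Prod.fst_add]
      omega)
    (fun k => by
      have := hz k k.2 (β k)
      rwa [shift_shift, ← neg_neg (s (β k) + _)] at this)
    (by
      rintro ⟨k, hk⟩ ⟨l, hl⟩ hkl
      have := hs (β k)
      have := hs (β l)
      have := hs' (β k)
      have := hs' (β l)
      simp only [Prod.fst_neg, Prod.fst_add, Prod.snd_neg, Prod.snd_add]
      rcases eq_or_ne k.1 l.1 with h | h
      · have := hsep k.2 l.2 fun h' => hkl (Subtype.ext (Prod.ext h h'))
        omega
      · have := hsep k.1 l.1 h
        omega)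
  obtain ⟨p', hp', h2⟩ := exists_glued_weave (ι := G) e' (D := D) (E := E) (R := R)
    (weave e q' z)
    (a := fun k => ((-(s (β k) + (N * k.1.1, N * k.1.2))).2, -(4 * (N * k.1.1))))
    (t := fun k => -(4 * (N * k.1.2)))
    (q := fun k => p (β k)) (x := fun k => weave e (q (β k)) (x (β k))) (fun _ => hp _)
    (fun _ => hp0 _)
    (fun k => by
      have := hs' (β k)
      simp only [Prod.snd_neg, Prod.snd_add]
      omega)
    h1
    (by
      rintro ⟨k, hk⟩ ⟨l, hl⟩ hkl
      have := hs' (β k)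
      have := hs' (β l)
      simp only [Prod.snd_neg, Prod.snd_add]
      rcases eq_or_ne k.1 l.1 with h | h
      · have := hsep k.2 l.2 fun h' => hkl (Subtype.ext (Prod.ext h h'))
        omega
      · have := hsep k.1 l.1 h
        omega)
  refine ⟨q', p', hq', hp', fun k hk => ?_⟩
  have := h2 ⟨k, hk⟩
  simpa only [Prod.neg_mk, neg_neg, ← mul_assoc] using this

theorem IsTransitivityPair.map_shift {W : Set (Config A)} (hW : ShiftInvariant W) {x x' : Config A}
    (h : IsTransitivityPair W x x') (g g' : ℤ × ℤ) :
    IsTransitivityPair W (shift g x) (shift g' x') :=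
  ⟨hW g x h.1, hW g' x' h.2.1, fun v v' hv hv' =>
    h.2.2 v v' (appearsIn_shift_iff.1 hv) (appearsIn_shift_iff.1 hv')⟩

theorem mem_double_fabric {e : Option A ≃ B} {e' : Option B ≃ C} {x : Config A} {y : Config C} :
    y ∈ setImage (fabric e') (fabric e x) ↔
      ∃ g q p, Lip q ∧ Lip p ∧ weave e' p (weave e q (shift g x)) = y := by
  rw [mem_setImage_fabric fun g v hv => orbit_subset_fabric x v hv (shift_mem_orbit g v)]
  constructor
  · rintro ⟨_, ⟨_, ⟨g, rfl⟩, q, hq, rfl⟩, p, hp, rfl⟩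
    exact ⟨g, q, p, hq, hp, rfl⟩
  · rintro ⟨g, q, p, hq, hp, rfl⟩
    exact ⟨_, weave_mem_fabric (shift_mem_orbit g x) hq, p, hp, rfl⟩

variable [TopologicalSpace A] [DiscreteTopology A] [TopologicalSpace C] [DiscreteTopology C]

theorem exists_forall_agree_mem {X K : Set (Config C)} {y : Config C} (h : K ∈ 𝓝[X] y) :
    ∃ R, ∀ R' ≥ R, ∀ z ∈ X, Agree R' z y → z ∈ K := by
  obtain ⟨R, -, hR⟩ := (nhdsWithin_hasBasis (nhds_hasBasis_agree y) X).mem_iff.1 h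
  exact ⟨R, fun R' hR' z hz hzy => hR ⟨hzy.mono hR', hz⟩⟩

/-- Transitivity gives an open set `U` of positive measure whose points show both windows at a fixed
offset `s`. Visits of one point to `U` along a sparse lattice have density at least `μ U`, and the
double weaves of that point alone realise every pattern of visits to `K` and `L` there. -/
theorem IsTransitivityPair.isEntropyOrEqualPair [Finite A] {e : Option A ≃ B}
    {e' : Option B ≃ C} {W : Set (Config A)} (hW : IsSubshift W)
    (hm : HasFullySupportedMeasure W) {x x' : Config A} (h : IsTransitivityPair W x x')
    {y y' : Config C} (hy : y ∈ setImage (fabric e') (fabric e x))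
    (hy' : y' ∈ setImage (fabric e') (fabric e x')) :
    IsEntropyOrEqualPair (setImage (fun x => setImage (fabric e') (fabric e x)) W) y y' := by
  classical
  set X := setImage (fun x => setImage (fabric e') (fabric e x)) W
  have hX : ShiftInvariant X := by
    have : X = setImage (fabric e') (setImage (fabric e) W) := setImage_setImage _ _ _
    rw [this]
    exact shiftInvariant_setImage orbit_subset_fabric _
  have hyX : y ∈ X := mem_setImage.2 ⟨x, h.1, hy⟩
  have hyX' : y' ∈ X := mem_setImage.2 ⟨x', h.2.1, hy'⟩
  refine ⟨hyX, hyX', or_iff_not_imp_left.2 fun hne => ⟨hyX, hyX', hne, ?_⟩⟩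
  intro K L _ _ _ _ hK hL hKL
  obtain ⟨g₁, q₁, p₁, hq₁, hp₁, rfl⟩ := mem_double_fabric.1 hy
  obtain ⟨g₂, q₂, p₂, hq₂, hp₂, rfl⟩ := mem_double_fabric.1 hy'
  obtain ⟨R₁, hR₁⟩ := exists_forall_agree_mem hK
  obtain ⟨R₂, hR₂⟩ := exists_forall_agree_mem hL
  let R := max R₁ R₂
  let D := (q₁ (0, 0)).natAbs + (q₂ (0, 0)).natAbs + (p₁ (0, 0)).natAbs + (p₂ (0, 0)).natAbs
  obtain ⟨z₀, hz₀, s, hs₁, hs₂⟩ :=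
    (h.map_shift hW.2 g₁ g₂).exists_agree hW.2 (D + 2 * (D + 2 * R))
  let _ : MeasurableSpace (Config A) := borel (Config A)
  have : BorelSpace (Config A) := ⟨rfl⟩
  obtain ⟨μ, hμ, hinv, hsupp⟩ := hm
  let U : Set (Config A) := {z | Agree (D + 2 * (D + 2 * R)) z (shift g₁ x)} ∩
    shift s ⁻¹' {z | Agree (D + 2 * (D + 2 * R)) z (shift g₂ x')}
  have hU : IsOpen U := (isClopen_agree _ _).isOpen.inter
    ((isClopen_agree _ _).isOpen.preimage (continuous_shift s))
  have hUpos : 0 < μ U := (Measure.mem_support_iff_forall z₀).1 (hsupp ▸ hz₀) U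
    (hU.mem_nhds ⟨hs₁, hs₂⟩)
  let E := 4 * s.1.natAbs + 4 * s.2.natAbs
  let N := 2 * (D + E + 4 * (D + 2 * (D + 2 * R))) + 1 + E
  refine coverEntropy_pos (C := 4 * N) hX hKL (ENNReal.toReal_pos hUpos.ne' (by finiteness))
    (by omega) fun m => ?_
  obtain ⟨z, hzW, G, hGm, hGcard, hGU⟩ := exists_card_visits_ge hinv (W := W)
    (hsupp ▸ Measure.measure_compl_support) hU.measurableSet N m
  let φ : ℤ × ℤ → ℤ × ℤ := fun k => (4 * N * k.1, 4 * N * k.2)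
  have hN : (4 * N : ℤ) ≠ 0 := by omega
  have hφ : Function.Injective φ := by
    intro k l hkl
    have h1 := congrArg Prod.fst hkl
    have h2 := congrArg Prod.snd hkl
    exact Prod.ext (mul_left_cancel₀ hN h1) (mul_left_cancel₀ hN h2)
  refine ⟨G.image φ, ?_, by rwa [Finset.card_image_of_injective _ hφ], fun Q _ => ?_⟩
  · intro g hg
    obtain ⟨k, hk, rfl⟩ := Finset.mem_image.1 hg
    obtain ⟨⟨h1, h2⟩, h3, h4⟩ := hGm hk
    have hN' : (0 : ℤ) < 4 * N := by omega
    simp only [box, φ, mem_prod, mem_Ico, Nat.cast_mul, Nat.cast_ofNat]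
    exact ⟨⟨by positivity, by gcongr⟩, by positivity, by gcongr⟩
  · obtain ⟨q', p', hq', hp', hag⟩ := exists_double_weave e e' (D := D) (E := E) (R := R) (N := N) z
      (q := fun c => if c then q₁ else q₂) (p := fun c => if c then p₁ else p₂)
      (x := fun c => if c then shift g₁ x else shift g₂ x')
      (s := fun c => if c then 0 else s) (by simp [hq₁, hq₂]) (by simp [hp₁, hp₂])
      (by simp only [Bool.forall_bool]; simp [D]; omega)
      (by simp only [Bool.forall_bool]; simp [D]; omega)
      (by simp [E]) (by simp [E]) le_rfl (G := G) (by
        intro k hk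
        have := hGU k hk
        simp only [Bool.forall_bool, Bool.false_eq_true, if_true, if_false, shift_zero]
        exact ⟨this.2, this.1⟩)
      (fun k => decide (φ k ∈ Q))
    have hY : weave e' p' (weave e q' z) ∈ X := mem_setImage.2 ⟨z, hzW, mem_double_fabric.2
      ⟨0, q', p', hq', hp', by rw [shift_zero]⟩⟩
    refine ⟨_, hY, fun g hg => ?_⟩
    obtain ⟨k, hk, rfl⟩ := Finset.mem_image.1 hg
    have hk' := hag k hk
    refine ⟨fun hQ => hR₁ R (le_max_left _ _) _ (hX _ _ hY) ?_,
      fun hQ => hR₂ R (le_max_right _ _) _ (hX _ _ hY) ?_⟩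
    · simpa only [hQ, decide_true, if_true] using hk'
    · simpa only [hQ, decide_false, Bool.false_eq_true, if_false] using hk'

end Independence

end Fabric

theorem mainTheorem11 (A : Type*) [Finite A] [TopologicalSpace A] [DiscreteTopology A] :
    ∃ (B : Type) (_ : Finite B) (_ : TopologicalSpace B) (_ : DiscreteTopology B)
      (f : Fabric.Config A → Set (Fabric.Config B)),
      -- `f` depends only on the orbit, and its values are nonempty unions of orbits
      (∀ x x' : Fabric.Config A, Fabric.orbit x = Fabric.orbit x' → f x = f x') ∧
      (∀ x : Fabric.Config A, (f x).Nonempty ∧ ∀ y ∈ f x, Fabric.orbit y ⊆ f x) ∧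
      -- distinct orbits have disjoint images
      (∀ x x' : Fabric.Config A, Fabric.orbit x ≠ Fabric.orbit x' → f x ∩ f x' = ∅) ∧
      -- subshifts and shifts of finite type are preserved
      (∀ W : Set (Fabric.Config A), Fabric.IsSubshift W →
        Fabric.IsSubshift (Fabric.setImage f W)) ∧
      (∀ W : Set (Fabric.Config A), Fabric.IsSFT W → Fabric.IsSFT (Fabric.setImage f W)) ∧
      -- fully supported measures are preserved
      (∀ W : Set (Fabric.Config A), Fabric.IsSubshift W → Fabric.HasFullySupportedMeasure W →
        Fabric.HasFullySupportedMeasure (Fabric.setImage f W)) ∧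
      -- transitivity pairs correspond to entropy-or-equal pairs
      (∀ W : Set (Fabric.Config A), Fabric.IsSubshift W → Fabric.HasFullySupportedMeasure W →
        ∀ x ∈ W, ∀ x' ∈ W,
          List.TFAE [
            Fabric.IsTransitivityPair W x x',
            ∃ y ∈ f x, ∃ y' ∈ f x', Fabric.IsEntropyOrEqualPair (Fabric.setImage f W) y y',
            ∀ y ∈ f x, ∀ y' ∈ f x', Fabric.IsEntropyOrEqualPair (Fabric.setImage f W) y y']) ∧
      -- closures of shift-invariant sets are preserved
      (∀ W : Set (Fabric.Config A), Fabric.IsSubshift W →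
        ∀ S : Set (Fabric.Config A), S ⊆ W → Fabric.ShiftInvariant S → ∀ x ∈ W,
          (x ∈ closure S ↔ f x ⊆ closure (Fabric.setImage f S))) := by
  obtain ⟨n, ⟨e₀⟩⟩ := Finite.exists_equiv_fin A
  -- Each of the two fabrics adds its own blank symbol to the alphabet.
  let e : Option A ≃ Fin (n + 1) := (Equiv.optionCongr e₀).trans (finSuccEquiv n).symm
  let e' : Option (Fin (n + 1)) ≃ Fin (n + 2) := (finSuccEquiv (n + 1)).symm
  have hf := (Fabric.isOrbitCoding_fabric e').comp (Fabric.isOrbitCoding_fabric e)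
  refine ⟨Fin (n + 2), inferInstance, inferInstance, inferInstance, _, hf.congr,
    fun x => ⟨hf.nonempty x, hf.orbit_subset x⟩, fun x x' hx => ?_, hf.isSubshift, hf.isSFT,
    hf.measure, fun W hW hm x hx x' hx' => ?_, fun W _ S _ hS x _ => hf.closure_iff S hS x⟩
  · exact eq_empty_of_forall_notMem fun y hy => hx (hf.orbit_eq x x' y hy.1 hy.2)
  · tfae_have 1 → 3 := fun h y hy y' hy' => h.isEntropyOrEqualPair hW hm hy hy'
    tfae_have 3 → 2 := fun h => by
      obtain ⟨y, hy⟩ := hf.nonempty x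
      obtain ⟨y', hy'⟩ := hf.nonempty x'
      exact ⟨y, hy, y', hy', h y hy y' hy'⟩
    tfae_have 2 → 1 := fun ⟨y, hy, y', hy', h⟩ => hf.reflects W hW.2 x hx x' hx' y hy y' hy'
      (h.isTransitivityPair (hf.isSubshift W hW))
    tfae_finish
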